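/- Let $k\ge 2$. A $k$-graph $H=(V,E)$ consists of a finite non-empty vertex set $V$ and a set $E$ of $k$-element subsets of $V$; write $v(H)=|V|$. The minimum degree $\delta_1(H)$ is the minimum over $v\in V$ of the number of edges containing $v$. For $p\in[0,1]$ and $\mu>0$, a $k$-graph $H=(V,E)$ with $n$ vertices is called $(p,\mu)$-edge-dense if for all $X\subseteq V$ and $Y\subseteq V^{k-1}$ the number of pairs $(x,(y_1,\dots,y_{k-1}))\in X\times Y$ with $\{x,y_1,\dots,y_{k-1}\}\in E$ is at least $p|X||Y|-\mu n^k$. A copy of $F$ in $H$ is a (not necessarily induced) subhypergraph of $H$ isomorphic to $F$. An $F$-factor in $H$ is a set of pairwise vertex-disjoint copies of $F$ in $H$ that together cover $V(H)$. Let $\mathbf{FACTOR}_k^{\mathrm{edge},1}$ be the collection of all $k$-graphs $F$ such that for all $0<p,\alpha<1$ there are $n_0\in\mathbb N$ and $\mu>0$ such that every $(p,\mu)$-edge-dense $k$-graph $H$ on $n\ge n_0$ vertices with $\delta_1(H)\ge\alpha n^{k-1}$ and $v(F)\mid n$ has an $F$-factor. Let $\mathbf{COVER}_k^{\mathrm{edge},1}$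 be the collection of all $k$-graphs $F$ such that for all $0<p,\alpha<1$ there are $n_0\in\mathbb N$ and $\mu>0$ such that in every $(p,\mu)$-edge-dense $k$-graph $H$ on $n\ge n_0$ vertices with $\delta_1(H)\ge\alpha n^{k-1}$, every vertex of $H$ is contained in a copy of $F$. **Theorem.** For every $k\ge2$, $\mathbf{FACTOR}_k^{\mathrm{edge},1}=\mathbf{COVER}_k^{\mathrm{edge},1}$. -/

import Mathlib

/-- A `k`-uniform hypergraph (`k`-graph) with vertex set `V`: a set of `k`-element subsets
of `V`. The vertex set is taken to be a finite type wherever `k`-graphs are used below. -/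
structure KGraph (k : ℕ) (V : Type*) where
  edges : Finset (Finset V)
  card_eq : ∀ e ∈ edges, e.card = k

namespace KGraph

variable {k : ℕ} {V W : Type*}

open scoped Classical in
/-- `deg_H(S)`: the number of edges of `H` that contain `S`. -/
noncomputable def degree (H : KGraph k V) (S : Finset V) : ℕ :=
  (H.edges.filter fun e => S ⊆ e).card

/-- The minimum `s`-degree `δ_s(H)`: the minimum of `deg_H(S)` over all `s`-subsets `S` of `V`
(such sets exist as soon as `s ≤ |V|`). -/
noncomputable def minDegree (H : KGraph k V) (s : ℕ) : ℕ :=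
  sInf {d : ℕ | ∃ S : Finset V, S.card = s ∧ H.degree S = d}

open scoped Classical in
/-- `e(X, Y)`: the number of pairs `(x, (y₁, …, y_{k-1})) ∈ X × Y` such that
`{x, y₁, …, y_{k-1}}` is an edge of `H`. -/
noncomputable def edgeCount (H : KGraph k V) (X : Finset V) (Y : Finset (Fin (k - 1) → V)) : ℕ :=
  ((X ×ˢ Y).filter fun q => insert q.1 (Finset.univ.image q.2) ∈ H.edges).card

/-- `H` is `(p, μ)`-dense in the "vertex versus `(k-1)`-tuple" (edge) sense:
`e(X, Y) ≥ p |X| |Y| - μ n ^ k` for all `X ⊆ V` and `Y ⊆ V ^ (k-1)`, where `n = |V|`. -/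
def IsEdgeDense [Fintype V] (H : KGraph k V) (p μ : ℝ) : Prop :=
  ∀ (X : Finset V) (Y : Finset (Fin (k - 1) → V)),
    p * (X.card : ℝ) * (Y.card : ℝ) - μ * (Fintype.card V : ℝ) ^ k ≤ (H.edgeCount X Y : ℝ)

/-- A copy of `F` in `H` (not necessarily induced): an injection of the vertex sets that maps
every edge of `F` to an edge of `H`. -/
structure Copy (F : KGraph k W) (H : KGraph k V) where
  emb : W ↪ V
  map_edge : ∀ e ∈ F.edges, e.map emb ∈ H.edges

/-- The vertex set of a copy of `F` in `H`. -/
def Copy.verts {F : KGraph k W} {H : KGraph k V} (c : Copy F H) : Set V :=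
  Set.range c.emb

/-- `H` has an `F`-cover: every vertex of `H` is contained in a copy of `F`. -/
def HasCover (F : KGraph k W) (H : KGraph k V) : Prop :=
  ∀ v : V, ∃ c : Copy F H, v ∈ c.verts

/-- `H` has an `F`-factor: there is a set of pairwise vertex-disjoint copies of `F` in `H`
that together cover the vertex set of `H`. -/
def HasFactor (F : KGraph k W) (H : KGraph k V) : Prop :=
  ∃ T : Set (Copy F H), (∀ c ∈ T, ∀ c' ∈ T, c ≠ c' → Disjoint c.verts c'.verts) ∧
    ∀ v : V, ∃ c ∈ T, v ∈ c.verts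

/-- The `k`-graphs `F` on the vertex set `W` that belong to `FACTOR_k^{edge,s}`. The hosts `H`
range over all finite `k`-graphs; since membership depends on `H` only up to isomorphism, it
suffices to let the vertex set of `H` be a finite type in the lowest universe. -/
def edgeFACTOR (k s : ℕ) (W : Type*) [Fintype W] : Set (KGraph k W) :=
  {F | ∀ p α : ℝ, 0 < p → p < 1 → 0 < α → α < 1 →
    ∃ (n₀ : ℕ) (μ : ℝ), 0 < μ ∧
      ∀ (V : Type) [Fintype V] (H : KGraph k V),
        n₀ ≤ Fintype.card V →
        H.IsEdgeDense p μ →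
        α * (Fintype.card V : ℝ) ^ (k - s) ≤ (H.minDegree s : ℝ) →
        Fintype.card W ∣ Fintype.card V →
        HasFactor F H}

/-- The `k`-graphs `F` on the vertex set `W` that belong to `COVER_k^{edge,s}`. -/
def edgeCOVER (k s : ℕ) (W : Type*) : Set (KGraph k W) :=
  {F | ∀ p α : ℝ, 0 < p → p < 1 → 0 < α → α < 1 →
    ∃ (n₀ : ℕ) (μ : ℝ), 0 < μ ∧
      ∀ (V : Type) [Fintype V] (H : KGraph k V),
        n₀ ≤ Fintype.card V →
        H.IsEdgeDense p μ →
        α * (Fintype.card V : ℝ) ^ (k - s) ≤ (H.minDegree s : ℝ) →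
        HasCover F H}

end KGraph

/-! A factor covers every vertex. So FACTOR ⊆ COVER only requires repairing divisibility: deleting
fewer than v(F) vertices, none of them the vertex to be covered, barely affects density and degrees.

The converse is by absorption. Its engine is supersaturation (`exists_card_isRootedHom_ge`). Take
any property L of vertex sets that holds for the entry sets of a positive proportion of
(k-1)-tuples, and regard it as the link of a virtual vertex. Then for a suitable root ρ of F, a
positive proportion of all maps W → V become homomorphisms once ρ is sent to a vertex whose link
contains L. To see this, sample a bounded number of vertices at random, add a root with link L, and
apply the cover property to the sample. For that the sample must be dense. Density of a relation is
controlled in both directions by the number of missed patterns K_{q,q} (`RelDense.sum_avoid_le`,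
`relDense_of_sum_avoid_lt`), up to a loss in p. That number is an average over tuples, so sampling
preserves it in expectation. The cover property needs large degree only at the root, since the other
low-degree vertices are few and can be deleted (`exists_isHom_of_tupleDegree`).

Now apply this to L = common link of r and x. Edge density, tested against the link of r, shows that
for all but few x this common link has positive density. So many maps can be completed both by x and
by r. Given a request R : W → V, choose a homomorphism z and, for each w, such a map for the pair z
w, R w. Completing these maps by z gives a W × W matrix whose rows are homomorphisms. Exchanging the
entries z w for R w keeps the rows homomorphisms and frees z, which is one more homomorphism. A
positive proportion of all matrices absorb R in this way (`exists_card_absorbs_ge`).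

A random selection of linearly many matrices, cleaned of coincidences, is a disjoint family that
serves every request linearly often (`exists_disjoint_family`). A maximal tiling outside the family
leaves fewer vertices than that, because every linear-sized set contains a copy of F. The family
absorbs the leftover. -/

/-! ### Density of a bipartite relation versus counts of missed complete bipartite patterns. -/

section BipartiteDensity

open Finset
open scoped Classical

set_option linter.unusedSectionVars false

variable {X Y : Type*} [Fintype X] [Fintype Y]

/-- One-sided density of a relation between two finite types: every pair of subsets `A`, `B` spans
at least `p |A| |B| - μ |X| |Y|` related pairs. -/
def RelDense (R : X → Y → Prop) (p μ : ℝ) : Prop :=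
  ∀ (A : Finset X) (B : Finset Y),
    p * #A * #B - μ * (Fintype.card X * Fintype.card Y) ≤ ∑ x ∈ A, (#{y ∈ B | R x y} : ℝ)

/-- The elements of `Y` that are related to no entry of the tuple `Q`. -/
noncomputable def avoid (R : X → Y → Prop) {q : ℕ} (Q : Fin q → X) : Finset Y :=
  {y | ∀ i, ¬ R (Q i) y}

/-- The density inequality is tested on B and the exceptional set itself: low degrees give that pair
at most half of the main term, so the error term must pay for the rest. -/
theorem RelDense.card_bad {R : X → Y → Prop} {p μ : ℝ} (h : RelDense R p μ) (B : Finset Y) :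
    p / 2 * #{x | (#{y ∈ B | R x y} : ℝ) < p / 2 * #B} * #B
      ≤ μ * (Fintype.card X * Fintype.card Y) := by
  set D : Finset X := {x | (#{y ∈ B | R x y} : ℝ) < p / 2 * #B} with hD
  have h1 := h D B
  have h2 : ∑ x ∈ D, (#{y ∈ B | R x y} : ℝ) ≤ #D * (p / 2 * #B) := by
    rw [← nsmul_eq_mul]
    refine Finset.sum_le_card_nsmul _ _ _ fun x hx => ?_
    rw [hD, mem_filter] at hx
    exact hx.2.le
  linarith

theorem avoid_cons (R : X → Y → Prop) {q : ℕ} (Q : Fin q → X) (x : X) :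
    avoid R (Fin.cons x Q : Fin (q + 1) → X) = {y ∈ avoid R Q | ¬ R x y} := by
  ext y
  simp [avoid, Fin.forall_fin_succ, and_comm]

theorem card_avoid_cons (R : X → Y → Prop) {q : ℕ} (Q : Fin q → X) (x : X) :
    (#(avoid R (Fin.cons x Q : Fin (q + 1) → X)) : ℝ)
      = #(avoid R Q) - #{y ∈ avoid R Q | R x y} := by
  rw [avoid_cons, eq_sub_iff_add_eq, add_comm]
  exact_mod_cast card_filter_add_card_filter_not (s := avoid R Q) (fun y => R x y)

theorem sum_fin_succ_eq {q : ℕ} (f : (Fin (q + 1) → X) → ℝ) :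
    ∑ Q, f Q = ∑ Q : Fin q → X, ∑ x, f (Fin.cons x Q) := by
  rw [sum_comm, ← Fintype.sum_prod_type']
  exact (Equiv.sum_comp (Fin.consEquiv fun _ => X) f).symm

/-- In a dense relation a random long tuple leaves almost nothing unrelated. -/
theorem RelDense.sum_avoid_le {R : X → Y → Prop} {p μ δ : ℝ} (h : RelDense R p μ) (hp : 0 < p)
    (hp1 : p < 1) (hμ : 0 ≤ μ) (hδ : 0 < δ) (q r : ℕ) :
    ∑ Q : Fin q → X, ((#(avoid R Q) : ℝ) / Fintype.card Y) ^ r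
      ≤ (Fintype.card X : ℝ) ^ q *
        ((1 - p / 2) ^ (r * q) + q * (2 * μ / (p * δ) + δ ^ r)) := by
  induction q with
  | zero =>
    have h1 : (#(avoid R (default : Fin 0 → X)) : ℝ) / Fintype.card Y ≤ 1 :=
      div_le_one_of_le₀ (by exact_mod_cast card_le_univ _) (by positivity)
    simpa using pow_le_one₀ (by positivity) h1
  | succ q ih =>
    set ε := 2 * μ / (p * δ) with hε
    have hε0 : 0 ≤ ε := by positivity
    have key : ∀ Q : Fin q → X,
        ∑ x, ((#(avoid R (Fin.cons x Q : Fin (q + 1) → X)) : ℝ) / Fintype.card Y) ^ r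
          ≤ Fintype.card X * ((1 - p / 2) ^ r * ((#(avoid R Q) : ℝ) / Fintype.card Y) ^ r
            + (ε + δ ^ r)) := by
      intro Q
      set g := (#(avoid R Q) : ℝ) / Fintype.card Y with hg
      have hg0 : 0 ≤ g := by positivity
      have hle : ∀ x, (#(avoid R (Fin.cons x Q : Fin (q + 1) → X)) : ℝ) / Fintype.card Y ≤ g := by
        intro x
        rw [hg, card_avoid_cons]
        gcongr
        have : (0 : ℝ) ≤ #{y ∈ avoid R Q | R x y} := by positivity
        linarith
      have hb : 0 ≤ (1 - p / 2) ^ r * g ^ r :=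
        mul_nonneg (pow_nonneg (by linarith) _) (pow_nonneg hg0 _)
      -- If the unrelated fraction is already below δ, it contributes at most δ ^ r. Otherwise
      -- `card_bad` applies to the unrelated set: all but a fraction ε of the x shrink it by the
      -- factor 1 - p/2, and the exceptional x are bounded trivially by 1.
      rcases lt_or_ge g δ with hgδ | hgδ
      · calc ∑ x, ((#(avoid R (Fin.cons x Q : Fin (q + 1) → X)) : ℝ) / Fintype.card Y) ^ r
            ≤ ∑ _x : X, δ ^ r := by
              refine sum_le_sum fun x _ => ?_
              exact pow_le_pow_left₀ (by positivity) ((hle x).trans hgδ.le) _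
          _ = Fintype.card X * δ ^ r := by simp
          _ ≤ _ := by gcongr; linarith
      · have hY : (0 : ℝ) < Fintype.card Y := by
          rcases Nat.eq_zero_or_pos (Fintype.card Y) with h0 | h0
          · simp [hg, h0] at hgδ; linarith
          · exact_mod_cast h0
        have hg1 : g ≤ 1 := div_le_one_of_le₀ (by exact_mod_cast card_le_univ _) hY.le
        set D : Finset X := {x | (#{y ∈ avoid R Q | R x y} : ℝ) < p / 2 * #(avoid R Q)} with hD
        have hDle : (#D : ℝ) ≤ Fintype.card X * ε := by
          have h1 := h.card_bad (avoid R Q)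
          rw [← hD] at h1
          have h2 : δ * Fintype.card Y ≤ #(avoid R Q) := (le_div_iff₀ hY).1 hgδ
          have h3 : p / 2 * #D * (δ * Fintype.card Y)
              ≤ μ * (Fintype.card X * Fintype.card Y) :=
            (mul_le_mul_of_nonneg_left h2 (by positivity)).trans h1
          have h4 : p / 2 * #D * δ ≤ μ * Fintype.card X := by
            refine le_of_mul_le_mul_right (?_ : _ * (Fintype.card Y : ℝ) ≤ _ * _) hY
            linarith
          rw [hε, ← mul_div_assoc, le_div_iff₀ (by positivity)]
          linarith
        calc ∑ x, ((#(avoid R (Fin.cons x Q : Fin (q + 1) → X)) : ℝ) / Fintype.card Y) ^ r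
            ≤ ∑ x : X, ((1 - p / 2) ^ r * g ^ r + if x ∈ D then 1 else 0) := by
              refine sum_le_sum fun x _ => ?_
              split_ifs with hx
              · have : ((#(avoid R (Fin.cons x Q : Fin (q + 1) → X)) : ℝ) / Fintype.card Y) ^ r
                    ≤ 1 := pow_le_one₀ (by positivity) ((hle x).trans hg1)
                linarith
              · rw [add_zero, ← mul_pow]
                refine pow_le_pow_left₀ (by positivity) ?_ _
                rw [hD, mem_filter] at hx
                simp only [mem_univ, true_and, not_lt] at hx
                rw [card_avoid_cons, hg, ← mul_div_assoc]
                gcongr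
                linarith
          _ = Fintype.card X * ((1 - p / 2) ^ r * g ^ r) + #D := by
              rw [sum_add_distrib]; simp
          _ ≤ _ := by
              have : 0 ≤ Fintype.card X * δ ^ r := by positivity
              linarith
    rw [sum_fin_succ_eq]
    calc _ ≤ ∑ Q : Fin q → X, Fintype.card X *
            ((1 - p / 2) ^ r * ((#(avoid R Q) : ℝ) / Fintype.card Y) ^ r + (ε + δ ^ r)) :=
          sum_le_sum fun Q _ => key Q
      _ = Fintype.card X * ((1 - p / 2) ^ r *
            ∑ Q : Fin q → X, ((#(avoid R Q) : ℝ) / Fintype.card Y) ^ r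
            + Fintype.card X ^ q * (ε + δ ^ r)) := by
          rw [← mul_sum, sum_add_distrib, ← mul_sum, sum_const, card_univ, nsmul_eq_mul,
            Fintype.card_fun, Fintype.card_fin, Nat.cast_pow]
      _ ≤ Fintype.card X * ((1 - p / 2) ^ r * (Fintype.card X ^ q *
            ((1 - p / 2) ^ (r * q) + q * (ε + δ ^ r))) + Fintype.card X ^ q * (ε + δ ^ r)) := by
          have : 0 ≤ (1 - p / 2) ^ r := pow_nonneg (by linarith) _
          gcongr
      _ = (Fintype.card X : ℝ) ^ (q + 1) * ((1 - p / 2) ^ (r * (q + 1))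
            + ((1 - p / 2) ^ r * (q * (ε + δ ^ r)) + (ε + δ ^ r))) := by ring
      _ ≤ _ := by
          have h1 : (1 - p / 2) ^ r ≤ 1 := pow_le_one₀ (by linarith) (by linarith)
          have h2 : 0 ≤ (q : ℝ) * (ε + δ ^ r) := by positivity
          have := mul_le_mul_of_nonneg_right h1 h2
          push_cast
          gcongr
          linarith

/-- Convexity of the n-th power: a lower bound on the average passes to the n-th moment. -/
theorem card_mul_pow_le_sum_pow {ι : Type*} (s : Finset ι) (f : ι → ℝ) (hf : ∀ i ∈ s, 0 ≤ f i)
    {b : ℝ} (hb : 0 ≤ b) (h : #s * b ≤ ∑ i ∈ s, f i) (n : ℕ) :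
    #s * b ^ n ≤ ∑ i ∈ s, f i ^ n := by
  rcases s.eq_empty_or_nonempty with rfl | hs
  · simp
  cases n with
  | zero => simp
  | succ n =>
    have hs' : (0 : ℝ) < #s := by exact_mod_cast hs.card_pos
    refine le_trans ?_ (pow_sum_div_card_le_sum_pow hf n)
    rw [le_div_iff₀ (by positivity)]
    calc #s * b ^ (n + 1) * #s ^ n = (#s * b) ^ (n + 1) := by ring
      _ ≤ _ := by gcongr

/-- A relation in which few complete bipartite patterns `K_{q,r}` are missed is dense. -/
theorem relDense_of_sum_avoid_lt {R : X → Y → Prop} {p ν : ℝ} (hp1 : p < 1)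
    (hν : 0 < ν) (q r : ℕ)
    (h : ∑ Q : Fin q → X, (#(avoid R Q) : ℝ) ^ r
      < ν ^ (q + r) * (1 - p) ^ (q * r) * (Fintype.card X ^ q * Fintype.card Y ^ r)) :
    RelDense R p ν := by
  intro A B
  by_contra! hlt
  set N := (Fintype.card X : ℝ)
  set M := (Fintype.card Y : ℝ)
  have hsum0 : 0 ≤ ∑ x ∈ A, (#{y ∈ B | R x y} : ℝ) := by positivity
  have hA : (#A : ℝ) ≤ N := Nat.cast_le.2 (card_le_univ _)
  have hB : (#B : ℝ) ≤ M := Nat.cast_le.2 (card_le_univ _)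
  have hN0 : 0 ≤ N := by positivity
  have hM0 : 0 ≤ M := by positivity
  have hAB : ν * (N * M) < p * #A * #B := by linarith
  have hAB' : ν * (N * M) < #A * #B := by
    refine hAB.trans_le ?_
    have : (0 : ℝ) ≤ #A * #B := by positivity
    nlinarith
  have hApos : (0 : ℝ) < #A := by
    rcases Nat.eq_zero_or_pos #A with h0 | h0
    · rw [h0] at hAB'; simp at hAB'
      have : 0 ≤ ν * (N * M) := by positivity
      linarith
    · exact_mod_cast h0
  have hBpos : (0 : ℝ) < #B := by
    rcases Nat.eq_zero_or_pos #B with h0 | h0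
    · rw [h0] at hAB'; simp at hAB'
      have : 0 ≤ ν * (N * M) := by positivity
      linarith
    · exact_mod_cast h0
  have hMpos : 0 < M := hBpos.trans_le hB
  have hNpos : 0 < N := hApos.trans_le hA
  have hA' : ν * N ≤ #A := by
    refine le_of_mul_le_mul_right (?_ : _ * M ≤ _ * M) hMpos
    have := mul_le_mul_of_nonneg_left hB hApos.le
    linarith
  have hB' : ν * M ≤ #B := by
    refine le_of_mul_le_mul_right (?_ : _ * N ≤ _ * N) hNpos
    have := mul_le_mul_of_nonneg_right hA hBpos.le
    linarith
  have he : ∑ x ∈ A, (#{y ∈ B | R x y} : ℝ) ≤ p * #A * #B := by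
    have : 0 ≤ ν * (N * M) := by positivity
    linarith
  have hdc : ∑ x ∈ A, (#{y ∈ B | R x y} : ℝ) = ∑ y ∈ B, (#{x ∈ A | R x y} : ℝ) := by
    exact_mod_cast sum_card_bipartiteAbove_eq_sum_card_bipartiteBelow R
  -- A violating pair A, B has non-edge density at least 1 - p and relative sizes at least ν.
  -- Convexity is used twice on the non-edges, with exponent q over B and then exponent r over
  -- q-tuples from A, and yields too many missed patterns.
  have hstep1 : #B * ((1 - p) * #A) ≤ ∑ y ∈ B, (#{x ∈ A | ¬ R x y} : ℝ) := by
    have : ∀ y ∈ B, (#{x ∈ A | ¬ R x y} : ℝ) = #A - #{x ∈ A | R x y} := by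
      intro y _
      rw [eq_sub_iff_add_eq, add_comm]
      exact_mod_cast card_filter_add_card_filter_not (s := A) (fun x => R x y)
    rw [sum_congr rfl this, sum_sub_distrib, ← hdc]
    simp only [sum_const, nsmul_eq_mul]
    linarith
  have hstep2 := card_mul_pow_le_sum_pow B _ (fun _ _ => by positivity)
    (mul_nonneg (by linarith) hApos.le) hstep1 q
  have hcount : ∑ y ∈ B, (#{x ∈ A | ¬ R x y} : ℝ) ^ q
      = ∑ Q ∈ Fintype.piFinset (fun _ : Fin q => A), (#{y ∈ B | ∀ i, ¬ R (Q i) y} : ℝ) := by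
    have h1 : ∑ y ∈ B, #{Q ∈ Fintype.piFinset (fun _ : Fin q => A) | ∀ i, ¬ R (Q i) y}
        = ∑ Q ∈ Fintype.piFinset (fun _ : Fin q => A), #{y ∈ B | ∀ i, ¬ R (Q i) y} :=
      (sum_card_bipartiteAbove_eq_sum_card_bipartiteBelow
        (fun (Q : Fin q → X) y => ∀ i, ¬ R (Q i) y)).symm
    rw [← Nat.cast_sum, ← h1, Nat.cast_sum]
    refine sum_congr rfl fun y _ => ?_
    have h2 : ({Q ∈ Fintype.piFinset (fun _ : Fin q => A) | ∀ i, ¬ R (Q i) y})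
        = Fintype.piFinset (fun _ : Fin q => {x ∈ A | ¬ R x y}) := by
      ext Q; simp [Fintype.mem_piFinset, forall_and]
    rw [h2, Fintype.card_piFinset]
    simp
  have hcardA : (#(Fintype.piFinset (fun _ : Fin q => A)) : ℝ) = #A ^ q := by
    simp [Fintype.card_piFinset]
  have hstep3 : #(Fintype.piFinset (fun _ : Fin q => A)) * (#B * (1 - p) ^ q)
      ≤ ∑ Q ∈ Fintype.piFinset (fun _ : Fin q => A), (#{y ∈ B | ∀ i, ¬ R (Q i) y} : ℝ) := by
    rw [← hcount, hcardA]
    refine le_trans (le_of_eq ?_) hstep2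
    rw [mul_pow]
    ring
  have h1p : 0 < 1 - p := by linarith
  have hstep4 := card_mul_pow_le_sum_pow _ _ (fun _ _ => by positivity)
    (by positivity) hstep3 r
  have hstep5 : ∑ Q ∈ Fintype.piFinset (fun _ : Fin q => A),
      (#{y ∈ B | ∀ i, ¬ R (Q i) y} : ℝ) ^ r ≤ ∑ Q : Fin q → X, (#(avoid R Q) : ℝ) ^ r := by
    refine (sum_le_sum fun Q _ => ?_).trans
      (sum_le_sum_of_subset_of_nonneg (subset_univ _) fun _ _ _ => by positivity)
    gcongr
    intro y
    simp [avoid]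
  have hfin : ν ^ (q + r) * (1 - p) ^ (q * r) * (N ^ q * M ^ r)
      ≤ #(Fintype.piFinset (fun _ : Fin q => A)) * (#B * (1 - p) ^ q) ^ r := by
    rw [hcardA]
    calc ν ^ (q + r) * (1 - p) ^ (q * r) * (N ^ q * M ^ r)
        = (ν * N) ^ q * ((ν * M) * (1 - p) ^ q) ^ r := by
          simp only [mul_pow, ← pow_mul, pow_add]; ring
      _ ≤ _ := by gcongr
  linarith

end BipartiteDensity

/-! ### Counting functions between finite sets: restrictions, collisions, prescribed values. -/

section CountingFunctions

open Finset
open scoped Classical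

/-- Restricting a uniformly random function along an injection gives a uniformly random function. -/
theorem card_comp_injective {U J V : Type*} [Fintype U] [DecidableEq U] [Fintype J]
    [DecidableEq J] [Fintype V] {c : J → U}
    (hc : Function.Injective c) (P : (J → V) → Prop) :
    #{φ : U → V | P (φ ∘ c)} * Fintype.card V ^ Fintype.card J
      = #{g : J → V | P g} * Fintype.card V ^ Fintype.card U := by
  set e : (U → V) ≃ (J → V) × ({u // ¬ u ∈ Set.range c} → V) :=
    (Equiv.piEquivPiSubtypeProd (fun u => u ∈ Set.range c) fun _ => V).trans
      (Equiv.prodCongr ((Equiv.ofInjective c hc).arrowCongr (Equiv.refl V)).symm (Equiv.refl _))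
    with he
  have h1 : ∀ φ, (e φ).1 = φ ∘ c := by
    intro φ
    ext j
    simp [he, Equiv.piEquivPiSubtypeProd, Equiv.arrowCongr, Equiv.ofInjective]
  have h2 : #{φ : U → V | P (φ ∘ c)}
      = #(({g : J → V | P g} : Finset (J → V)) ×ˢ
          (univ : Finset ({u // ¬ u ∈ Set.range c} → V))) := by
    refine card_equiv e fun φ => ?_
    simp [h1]
  have h3 : Fintype.card U = Fintype.card {u // ¬ u ∈ Set.range c} + Fintype.card J := by
    have h4 := Fintype.card_subtype_compl (fun u => u ∈ Set.range c)
    have h5 : Fintype.card {u // u ∈ Set.range c} = Fintype.card J :=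
      (Fintype.card_congr (Equiv.ofInjective c hc)).symm
    have h6 : Fintype.card J ≤ Fintype.card U := Fintype.card_le_of_injective c hc
    omega
  rw [h2, card_product, card_univ, Fintype.card_fun, h3, pow_add, mul_assoc]

theorem card_apply_mem {J V : Type*} [Fintype J] [DecidableEq J] [Fintype V] (j : J) (B : Finset V) :
    #{g : J → V | g j ∈ B} * Fintype.card V = #B * Fintype.card V ^ Fintype.card J := by
  have h : #{g : J → V | g j ∈ B} * Fintype.card V ^ Fintype.card Unit
      = #{g : Unit → V | g () ∈ B} * Fintype.card V ^ Fintype.card J := by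
    convert card_comp_injective (V := V) (c := fun _ : Unit => j)
      (fun _ _ _ => rfl) (fun g => g () ∈ B)
    rfl
  have h2 : #{g : Unit → V | g () ∈ B} = #B :=
    card_equiv (Equiv.funUnique Unit V) fun g => by simp
  rw [h2, Fintype.card_unit, pow_one] at h
  exact h

theorem card_exists_mem_le {J V : Type*} [Fintype J] [DecidableEq J] [Fintype V] (B : J → Finset V) {b : ℝ}
    (hb : ∀ j, (#(B j) : ℝ) ≤ b) :
    (#{g : J → V | ∃ j, g j ∈ B j} : ℝ) * Fintype.card V
      ≤ Fintype.card J * b * Fintype.card V ^ Fintype.card J := by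
  have h1 : (#{g : J → V | ∃ j, g j ∈ B j} : ℝ) ≤ ∑ j, (#{g : J → V | g j ∈ B j} : ℝ) := by
    have : ({g : J → V | ∃ j, g j ∈ B j} : Finset (J → V))
        = univ.biUnion fun j => {g : J → V | g j ∈ B j} := by
      ext; simp
    rw [this]
    exact_mod_cast card_biUnion_le
  calc _ ≤ (∑ j, (#{g : J → V | g j ∈ B j} : ℝ)) * Fintype.card V := by gcongr
    _ = ∑ j, (#(B j) : ℝ) * Fintype.card V ^ Fintype.card J := by
      rw [sum_mul]
      exact sum_congr rfl fun j _ => by exact_mod_cast card_apply_mem j (B j)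
    _ ≤ ∑ _j : J, b * Fintype.card V ^ Fintype.card J := by
      gcongr with j; exact hb j
    _ = _ := by simp; ring

theorem card_apply_eq_apply_le {J V : Type*} [Fintype J] [DecidableEq J] [Fintype V] {i j : J} (hij : i ≠ j) :
    #{g : J → V | g i = g j} * Fintype.card V ≤ Fintype.card V ^ Fintype.card J := by
  rw [← Fintype.card_fun, ← card_univ (α := V), ← card_product, ← card_univ]
  -- Overwriting the value at i loses nothing, since it can be read off at j.
  refine card_le_card_of_injOn (fun x => Function.update x.1 i x.2) (fun _ _ => mem_univ _) ?_
  rintro ⟨g, v⟩ hg ⟨g', v'⟩ hg' h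
  simp only [coe_product, coe_filter, mem_univ, true_and, coe_univ, Set.mem_prod,
    Set.mem_ofPred_eq, Set.mem_univ, and_true] at hg hg' h
  have hne : ∀ a, a ≠ i → g a = g' a := by
    intro a ha
    have := congrFun h a
    simpa [ha] using this
  have hv : v = v' := by simpa using congrFun h i
  refine Prod.ext (funext fun a => ?_) hv
  by_cases ha : a = i
  · subst ha
    exact hg.trans ((hne j hij.symm).trans hg'.symm)
  · exact hne a ha

theorem card_not_injective_le {J V : Type*} [Fintype J] [DecidableEq J] [Fintype V] :
    #{g : J → V | ¬ Function.Injective g} * Fintype.card V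
      ≤ Fintype.card J ^ 2 * Fintype.card V ^ Fintype.card J := by
  set D : Finset (J × J) := {x | x.1 ≠ x.2}
  have h1 : #{g : J → V | ¬ Function.Injective g} ≤ ∑ x ∈ D, #{g : J → V | g x.1 = g x.2} := by
    refine (card_le_card ?_).trans card_biUnion_le
    intro g hg
    simp only [mem_filter, mem_univ, true_and, Function.Injective, not_forall] at hg
    obtain ⟨a, b, hab, hne⟩ := hg
    exact mem_biUnion.2 ⟨(a, b), by simpa [D] using hne, by simpa using hab⟩
  calc _ ≤ (∑ x ∈ D, #{g : J → V | g x.1 = g x.2}) * Fintype.card V := by gcongr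
    _ ≤ ∑ x ∈ D, Fintype.card V ^ Fintype.card J := by
      rw [sum_mul]
      exact sum_le_sum fun x hx => card_apply_eq_apply_le (by simpa [D] using hx)
    _ ≤ _ := by
      rw [sum_const, smul_eq_mul]
      gcongr
      calc #D ≤ Fintype.card (J × J) := card_le_univ _
        _ = _ := by rw [Fintype.card_prod, sq]

end CountingFunctions

/-! ### Tuple degrees and restriction to vertex subsets. -/

namespace KGraph

open Finset
open scoped Classical

/-- The vertex `x` and the tuple `y` together form an edge of `H`. -/
def Hit {k : ℕ} {V : Type*} (H : KGraph k V) (x : V) (y : Fin (k - 1) → V) : Prop :=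
  insert x (univ.image y) ∈ H.edges

/-- The number of `(k-1)`-tuples that form an edge together with `x`. -/
noncomputable def tupleDegree {k : ℕ} {V : Type*} [Fintype V] (H : KGraph k V) (x : V) : ℕ :=
  #{y | H.Hit x y}

/-- A map of vertex sets that sends edges to edges. -/
def IsHom {k : ℕ} {V W : Type*} (F : KGraph k W) (H : KGraph k V) (g : W → V) : Prop :=
  ∀ e ∈ F.edges, e.image g ∈ H.edges

/-- The `k`-graph on `U` whose edges are the `k`-sets mapped to edges of `H`. -/
noncomputable def pullback {k : ℕ} {U V : Type*} [Fintype U] (H : KGraph k V) (φ : U → V) :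
    KGraph k U where
  edges := {e | #e = k ∧ e.image φ ∈ H.edges}
  card_eq e he := by simpa using (mem_filter.1 he).2.1

/-- The copy given by an injective homomorphism. -/
def IsHom.copy {k : ℕ} {V W : Type*} {F : KGraph k W} {H : KGraph k V} {g : W → V}
    (h : F.IsHom H g) (hg : Function.Injective g) : Copy F H where
  emb := ⟨g, hg⟩
  map_edge e he := by
    have := h e he
    convert this
    rw [map_eq_image]
    rfl

theorem Copy.isHom {k : ℕ} {V W : Type*} {F : KGraph k W} {H : KGraph k V} (c : Copy F H) :
    F.IsHom H c.emb := by
  intro e he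
  rw [← map_eq_image]
  exact c.map_edge e he

theorem isHom_pullback_comp {k : ℕ} {U V W : Type*} [Fintype U] {F : KGraph k W} {H : KGraph k V}
    {φ : U → V} {g : W → U} (h : F.IsHom (H.pullback φ) g) : F.IsHom H (φ ∘ g) := by
  intro e he
  have := (mem_filter.1 (h e he)).2.2
  rwa [image_image] at this

set_option linter.unusedSectionVars false

variable {k : ℕ} {U V W : Type*} [Fintype U] [Fintype V] (H : KGraph k V)

theorem edgeCount_eq (A : Finset V) (B : Finset (Fin (k - 1) → V)) :
    H.edgeCount A B = ∑ x ∈ A, #{y ∈ B | H.Hit x y} := by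
  unfold edgeCount
  simp only [card_filter]
  rw [sum_product]
  refine sum_congr rfl fun x _ => sum_congr rfl fun y _ => ?_
  by_cases h : insert x (univ.image y) ∈ H.edges <;> simp [Hit, h]

theorem isEdgeDense_iff (hk : 1 ≤ k) (p μ : ℝ) : H.IsEdgeDense p μ ↔ RelDense H.Hit p μ := by
  have h1 : (Fintype.card V : ℝ) ^ k
      = Fintype.card V * Fintype.card (Fin (k - 1) → V) := by
    rw [Fintype.card_fun, Fintype.card_fin, Nat.cast_pow, mul_pow_sub_one (by omega)]
  unfold IsEdgeDense RelDense
  simp only [edgeCount_eq, h1, Nat.cast_sum]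

theorem pullback_hit {φ : U → V} (hφ : Function.Injective φ) (x : U)
    (y : Fin (k - 1) → U) : (H.pullback φ).Hit x y ↔ H.Hit (φ x) (φ ∘ y) := by
  have h1 : (insert x (univ.image y)).image φ = insert (φ x) (univ.image (φ ∘ y)) := by
    rw [image_insert, image_image]
  unfold Hit pullback
  simp only [mem_filter, mem_univ, true_and, h1]
  refine and_iff_right_of_imp fun h => ?_
  have := H.card_eq _ h
  rwa [← h1, card_image_of_injective _ hφ] at this

/-- Only the normalisation of the error changes: n ^ k is at most |U| ^ k / c ^ k. -/
theorem relDense_pullback {φ : U → V} (hφ : Function.Injective φ) (hk : 1 ≤ k) {p μ c : ℝ}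
    (hμ : 0 ≤ μ) (hc : 0 < c) (hU : c * Fintype.card V ≤ Fintype.card U)
    (h : RelDense H.Hit p μ) : RelDense (H.pullback φ).Hit p (μ / c ^ k) := by
  intro A B
  have hφ' : Function.Injective (fun y : Fin (k - 1) → U => φ ∘ y) := hφ.comp_left
  have h1 := h (A.image φ) (B.image fun y => φ ∘ y)
  rw [card_image_of_injective _ hφ, card_image_of_injective _ hφ', sum_image hφ.injOn] at h1
  have h2 : ∀ x, #{y ∈ B.image fun y => φ ∘ y | H.Hit (φ x) y}
      = #{y ∈ B | (H.pullback φ).Hit x y} := by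
    intro x
    rw [filter_image, card_image_of_injective _ hφ']
    simp only [pullback_hit H hφ]
  simp only [h2] at h1
  refine le_trans (sub_le_sub_left ?_ _) h1
  have h3 : (Fintype.card U : ℝ)
      * Fintype.card (Fin (k - 1) → U) = (Fintype.card U : ℝ) ^ k := by
    rw [Fintype.card_fun, Fintype.card_fin, Nat.cast_pow, mul_pow_sub_one (by omega)]
  have h3' : (Fintype.card V : ℝ)
      * Fintype.card (Fin (k - 1) → V) = (Fintype.card V : ℝ) ^ k := by
    rw [Fintype.card_fun, Fintype.card_fin, Nat.cast_pow, mul_pow_sub_one (by omega)]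
  rw [h3, h3', div_mul_eq_mul_div, le_div_iff₀ (by positivity), mul_assoc, mul_comm _ (c ^ k),
    ← mul_pow]
  gcongr

/-- Every lost tuple has one of its k - 1 entries among the at most β n deleted vertices. -/
theorem tupleDegree_pullback_ge {φ : U → V} (hφ : Function.Injective φ) {β : ℝ}
    (hU : (Fintype.card V : ℝ) - Fintype.card U ≤ β * Fintype.card V) (u : U) :
    (H.tupleDegree (φ u) : ℝ) - k * β * Fintype.card V ^ (k - 1)
      ≤ (H.pullback φ).tupleDegree u := by
  set B : Finset V := (univ.image φ)ᶜ with hB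
  have hn : (0 : ℝ) < Fintype.card V := by
    exact_mod_cast Fintype.card_pos_iff.2 ⟨φ u⟩
  have hBc : (#B : ℝ) ≤ β * Fintype.card V := by
    rw [hB, card_compl, card_image_of_injective _ hφ, card_univ,
      Nat.cast_sub (Fintype.card_le_of_injective φ hφ)]
    exact hU
  have hβ : 0 ≤ β := by
    by_contra! hlt
    have := mul_neg_of_neg_of_pos hlt hn
    have h0 : (0 : ℝ) ≤ #B := by positivity
    linarith
  have h1 := card_exists_mem_le (J := Fin (k - 1)) (fun _ => B) (fun _ => hBc)
  have h2 : (#{g : Fin (k - 1) → V | ∃ j, g j ∈ B} : ℝ) ≤ k * β * Fintype.card V ^ (k - 1) := by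
    refine le_of_mul_le_mul_right (le_trans (le_of_eq_of_le (by congr!) h1) ?_) hn
    rw [Fintype.card_fin]
    have : ((k - 1 : ℕ) : ℝ) ≤ k := by exact_mod_cast Nat.sub_le _ _
    calc _ ≤ k * (β * Fintype.card V) * (Fintype.card V : ℝ) ^ (k - 1) := by gcongr
      _ = _ := by ring
  have h3 : H.tupleDegree (φ u)
      ≤ #{g : Fin (k - 1) → V | ∃ j, g j ∈ B} + (H.pullback φ).tupleDegree u := by
    unfold tupleDegree
    have h4 : ({y | H.Hit (φ u) y} : Finset (Fin (k - 1) → V))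
        ⊆ ({g : Fin (k - 1) → V | ∃ j, g j ∈ B} : Finset (Fin (k - 1) → V)) ∪
          ({y | (H.pullback φ).Hit u y} : Finset (Fin (k - 1) → U)).image (fun y => φ ∘ y) := by
      intro y hy
      rw [mem_union]
      by_cases hyB : ∃ j, y j ∈ B
      · left; simpa using hyB
      · right
        push Not at hyB
        have : ∀ j, ∃ a, φ a = y j := by
          intro j
          have := hyB j
          simpa [hB] using this
        choose z hz using this
        refine mem_image.2 ⟨z, ?_, funext hz⟩
        rw [mem_filter, pullback_hit H hφ]
        rw [mem_filter] at hy
        refine ⟨mem_univ _, ?_⟩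
        have hzy : φ ∘ z = y := funext hz
        rw [hzy]
        exact hy.2
    exact (card_le_card h4).trans ((card_union_le _ _).trans
      (Nat.add_le_add_left card_image_le _))
  have h5 : (H.tupleDegree (φ u) : ℝ)
      ≤ #{g : Fin (k - 1) → V | ∃ j, g j ∈ B} + (H.pullback φ).tupleDegree u := by
    exact_mod_cast h3
  linarith

theorem degree_le_tupleDegree (v : V) : H.degree {v} ≤ H.tupleDegree v := by
  unfold degree tupleDegree
  refine card_le_card_of_surjOn (fun y => insert v (univ.image y)) ?_
  intro e he
  simp only [coe_filter, Set.mem_ofPred_eq, singleton_subset_iff] at he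
  have h1 : #(e.erase v) = k - 1 := by rw [card_erase_of_mem he.2, H.card_eq e he.1]
  set f := (e.erase v).equivFinOfCardEq h1
  have h2 : univ.image (fun i => (f.symm i : V)) = e.erase v := by
    ext a
    simp only [mem_image, mem_univ, true_and]
    constructor
    · rintro ⟨i, rfl⟩; exact (f.symm i).2
    · intro ha; exact ⟨f ⟨a, ha⟩, by simp⟩
  have h3 : insert v (univ.image (fun i => (f.symm i : V))) = e := by
    rw [h2, insert_erase he.2]
  refine ⟨fun i => (f.symm i : V), ?_, h3⟩
  rw [mem_coe, mem_filter, Hit, h3]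
  exact ⟨mem_univ _, he.1⟩

/-- All entries of a tuple that spans the edge e with v lie in e, so e arises from at most k ^ (k -
1) tuples. The exact factor (k - 1)! is not needed, as only constants are at stake. -/
theorem tupleDegree_le_degree (v : V) : H.tupleDegree v ≤ k ^ (k - 1) * H.degree {v} := by
  unfold degree tupleDegree
  have h1 : #(({y | H.Hit v y} : Finset (Fin (k - 1) → V)).image
      fun y => insert v (univ.image y)) ≤ #{e ∈ H.edges | {v} ⊆ e} := by
    refine card_le_card fun e he => ?_
    obtain ⟨y, hy, rfl⟩ := mem_image.1 he
    rw [mem_filter] at hy ⊢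
    exact ⟨hy.2, by simp⟩
  refine (card_le_mul_card_image _ (k ^ (k - 1)) fun e he => ?_).trans
    (Nat.mul_le_mul_left _ h1)
  obtain ⟨y, hy, hye⟩ := mem_image.1 he
  rw [mem_filter] at hy
  have hek : #e = k := by rw [← hye]; exact H.card_eq _ hy.2
  calc _ ≤ #(Fintype.piFinset fun _ : Fin (k - 1) => e) := by
        refine card_le_card fun z hz => ?_
        rw [mem_filter] at hz
        rw [Fintype.mem_piFinset]
        intro i
        rw [← hz.2]
        exact mem_insert_of_mem (mem_image_of_mem _ (mem_univ i))
    _ = k ^ (k - 1) := by simp [Fintype.card_piFinset, hek]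

theorem minDegree_le_tupleDegree (v : V) : H.minDegree 1 ≤ H.tupleDegree v :=
  (Nat.sInf_le (Set.mem_ofPred.2 ⟨{v}, card_singleton v, rfl⟩)).trans (H.degree_le_tupleDegree v)

theorem le_minDegree [Nonempty V] {a : ℝ} (h : ∀ v, a ≤ H.tupleDegree v) :
    a ≤ (k : ℝ) ^ (k - 1) * H.minDegree 1 := by
  -- Nonemptiness matters: the infimum of an empty set of naturals is 0, which would make
  -- `minDegree` useless as an upper bound for a.
  have hne : {d : ℕ | ∃ S : Finset V, #S = 1 ∧ H.degree S = d}.Nonempty :=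
    ⟨_, Set.mem_ofPred.2 ⟨{Classical.arbitrary V}, card_singleton _, rfl⟩⟩
  obtain ⟨S, hS, hd⟩ :
      ∃ S : Finset V, #S = 1 ∧ H.degree S = H.minDegree 1 := Nat.sInf_mem hne
  obtain ⟨v, rfl⟩ := card_eq_one.1 hS
  have h1 : H.minDegree 1 = H.degree {v} := hd.symm
  rw [h1]
  exact (h v).trans (by exact_mod_cast H.tupleDegree_le_degree v)

end KGraph

theorem RelDense.mono {X Y : Type*} [Fintype X] [Fintype Y] {R : X → Y → Prop} {p μ μ' : ℝ}
    (h : RelDense R p μ) (hμ : μ ≤ μ') : RelDense R p μ' := by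
  intro A B
  refine le_trans (sub_le_sub_left ?_ _) (h A B)
  gcongr

/-! ### The cover property in terms of tuple degrees, its strengthenings, and FACTOR ⊆ COVER. -/

namespace KGraph

open Finset
open scoped Classical

variable {k : ℕ} {W : Type*}

/-- Invoking the definition with α / k ^ (k - 1) pays for passing from tuple degrees to edge
degrees. -/
theorem exists_isHom_of_mem_edgeCOVER (hk : 1 ≤ k) {F : KGraph k W} (hF : F ∈ edgeCOVER k 1 W)
    {p α : ℝ} (hp : 0 < p) (hp1 : p < 1) (hα : 0 < α) (hα1 : α < 1) :
    ∃ (n₀ : ℕ) (μ : ℝ), 0 < μ ∧ ∀ (V : Type) [Fintype V] (H : KGraph k V),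
      n₀ ≤ Fintype.card V → RelDense H.Hit p μ →
      (∀ v, α * (Fintype.card V : ℝ) ^ (k - 1) ≤ H.tupleDegree v) →
      ∀ v, ∃ g : W → V, F.IsHom H g ∧ Function.Injective g ∧ v ∈ Set.range g := by
  have hK : (1 : ℝ) ≤ (k : ℝ) ^ (k - 1) := one_le_pow₀ (by exact_mod_cast hk)
  obtain ⟨n₀, μ, hμ, h⟩ := Set.mem_ofPred.1 hF p (α / (k : ℝ) ^ (k - 1)) hp hp1 (by positivity)
    (lt_of_le_of_lt (div_le_self hα.le hK) hα1)
  refine ⟨n₀, μ, hμ, fun V _ H hn hd hdeg v => ?_⟩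
  have : Nonempty V := ⟨v⟩
  obtain ⟨c, hc⟩ := h V H hn ((H.isEdgeDense_iff hk p μ).2 hd) (by
    rw [div_mul_eq_mul_div, div_le_iff₀ (by positivity), mul_comm _ ((k : ℝ) ^ (k - 1))]
    exact H.le_minDegree hdeg) v
  exact ⟨c.emb, c.isHom, c.emb.injective, hc⟩

theorem hasFactor_of_mem_edgeFACTOR [Fintype W] (hk : 1 ≤ k) {F : KGraph k W}
    (hF : F ∈ edgeFACTOR k 1 W) {p α : ℝ} (hp : 0 < p) (hp1 : p < 1) (hα : 0 < α) (hα1 : α < 1) :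
    ∃ (n₀ : ℕ) (μ : ℝ), 0 < μ ∧ ∀ (V : Type) [Fintype V] [Nonempty V] (H : KGraph k V),
      n₀ ≤ Fintype.card V → RelDense H.Hit p μ →
      (∀ v, α * (Fintype.card V : ℝ) ^ (k - 1) ≤ H.tupleDegree v) →
      Fintype.card W ∣ Fintype.card V → HasFactor F H := by
  have hK : (1 : ℝ) ≤ (k : ℝ) ^ (k - 1) := one_le_pow₀ (by exact_mod_cast hk)
  obtain ⟨n₀, μ, hμ, h⟩ := Set.mem_ofPred.1 hF p (α / (k : ℝ) ^ (k - 1)) hp hp1 (by positivity)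
    (lt_of_le_of_lt (div_le_self hα.le hK) hα1)
  refine ⟨n₀, μ, hμ, fun V _ _ H hn hd hdeg hdvd => ?_⟩
  refine h V H hn ((H.isEdgeDense_iff hk p μ).2 hd) ?_ hdvd
  rw [div_mul_eq_mul_div, div_le_iff₀ (by positivity), mul_comm _ ((k : ℝ) ^ (k - 1))]
  exact H.le_minDegree hdeg

theorem edgeFACTOR_subset_edgeCOVER [Fintype W] [Nonempty W] (hk : 1 ≤ k) :
    edgeFACTOR k 1 W ⊆ edgeCOVER k 1 W := by
  intro F hF
  refine Set.mem_ofPred.2 ?_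
  intro p α hp hp1 hα hα1
  obtain ⟨n₁, μ, hμ, h⟩ := hasFactor_of_mem_edgeFACTOR hk hF hp hp1 (half_pos hα) (by linarith)
  set f := Fintype.card W with hf
  have hf0 : 0 < f := Fintype.card_pos
  have hk0 : (0 : ℝ) < k := by exact_mod_cast hk
  refine ⟨2 * n₁ + 2 * f + ⌈2 * k * f / α⌉₊, μ * (1 / 2) ^ k, by positivity, ?_⟩
  intro V _ H hn hd hdeg v
  set n := Fintype.card V with hn'
  have hn2 : 2 * k * f / α ≤ n := (Nat.le_ceil _).trans (Nat.cast_le.2 (by omega))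
  have hmod := Nat.mod_lt n hf0
  -- U keeps v and drops n mod v(F) vertices. The lower bound on n makes this loss at most α n /
  -- (2k), which costs at most half of the degree.
  obtain ⟨U, hvU, -, hUc⟩ := exists_subsuperset_card_eq (subset_univ {v})
    (n := n - n % f) (by rw [card_singleton]; omega) (by rw [card_univ]; omega)
  have hvU' : v ∈ U := singleton_subset_iff.1 hvU
  have : Nonempty U := ⟨⟨v, hvU'⟩⟩
  have hUcard : Fintype.card U = n - n % f := by rw [Fintype.card_coe, hUc]
  have hUn : Fintype.card U + n % f = n := by omega
  have hUnR : (Fintype.card U : ℝ) + (n % f : ℕ) = n := by exact_mod_cast hUn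
  have hmodR : ((n % f : ℕ) : ℝ) ≤ f := by exact_mod_cast hmod.le
  have hfn : 2 * (f : ℝ) ≤ n := by exact_mod_cast (by omega : 2 * f ≤ n)
  have hdeg' : ∀ u : U, α / 2 * (Fintype.card U : ℝ) ^ (k - 1)
      ≤ (H.pullback (Subtype.val : U → V)).tupleDegree u := by
    intro u
    have h1 := H.tupleDegree_pullback_ge (φ := (Subtype.val : U → V)) Subtype.val_injective
      (β := α / (2 * k)) (by
        rw [div_le_iff₀ hα] at hn2
        rw [div_mul_eq_mul_div, le_div_iff₀ (by positivity)]
        have : (n : ℝ) - Fintype.card U ≤ f := by linarith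
        nlinarith) u
    have h2 : α * (n : ℝ) ^ (k - 1) ≤ H.tupleDegree (u : V) :=
      hdeg.trans (by exact_mod_cast H.minDegree_le_tupleDegree (u : V))
    have h3 : (k : ℝ) * (α / (2 * k)) * n ^ (k - 1) = α / 2 * n ^ (k - 1) := by
      field_simp
    have h4 : α / 2 * (Fintype.card U : ℝ) ^ (k - 1) ≤ α / 2 * n ^ (k - 1) := by
      gcongr; omega
    rw [← hn', h3] at h1
    linarith
  obtain ⟨T, -, hT⟩ := h U (H.pullback (Subtype.val : U → V)) (by omega) (by
      have := H.relDense_pullback (φ := (Subtype.val : U → V)) Subtype.val_injective hk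
        (by positivity) (c := 1 / 2) (by norm_num) (by rw [← hn']; linarith)
        ((H.isEdgeDense_iff hk _ _).1 hd)
      rwa [mul_div_assoc, div_self (by positivity), mul_one] at this) hdeg' (by
      rw [hUcard]; exact Nat.dvd_sub_mod n)
  obtain ⟨c, -, hc⟩ := hT ⟨v, hvU'⟩
  obtain ⟨w, hw⟩ := hc
  refine ⟨(isHom_pullback_comp c.isHom).copy (Subtype.val_injective.comp c.emb.injective), w, ?_⟩
  show ((c.emb w : U) : V) = v
  rw [hw]

/-- In a dense host, one vertex of large degree suffices to find a copy through it. -/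
theorem exists_isHom_of_tupleDegree (hk : 1 ≤ k) {F : KGraph k W} (hF : F ∈ edgeCOVER k 1 W)
    {p α : ℝ} (hp : 0 < p) (hp1 : p < 1) (hα : 0 < α) :
    ∃ (n₀ : ℕ) (μ : ℝ), 0 < μ ∧ ∀ (V : Type) [Fintype V] (H : KGraph k V),
      n₀ ≤ Fintype.card V → RelDense H.Hit p μ →
      ∀ v, α * (Fintype.card V : ℝ) ^ (k - 1) ≤ H.tupleDegree v →
      ∃ g : W → V, F.IsHom H g ∧ Function.Injective g ∧ v ∈ Set.range g := by
  set γ := min α p with hγ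
  have hγ0 : 0 < γ := lt_min hα hp
  have hγα : γ ≤ α := min_le_left _ _
  have hγp : γ ≤ p := min_le_right _ _
  have hk0 : (0 : ℝ) < k := by exact_mod_cast hk
  have hk1 : (1 : ℝ) ≤ k := by exact_mod_cast hk
  obtain ⟨n₁, μ, hμ, h⟩ := exists_isHom_of_mem_edgeCOVER hk hF hp hp1
    (α := γ / 4) (by positivity) (by linarith)
  set β := γ / (4 * k) with hβ
  have hβ0 : 0 < β := by positivity
  have hkβ : k * β = γ / 4 := by rw [hβ]; field_simp
  have hβ4 : β ≤ 1 / 4 := by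
    have : β ≤ k * β := le_mul_of_one_le_left hβ0.le hk1
    linarith
  refine ⟨2 * n₁, min (μ * (1 / 2) ^ k) (p * β / 2), by positivity, ?_⟩
  intro V _ H hn hd v hv
  set n := Fintype.card V with hn'
  have hn0 : (0 : ℝ) < n := by exact_mod_cast Fintype.card_pos_iff.2 ⟨v⟩
  -- By density at most β n vertices have degree below p/2. Restricting to U costs k β = γ/4 of the
  -- degrees, which are at least γ/2 on U, so the minimum-degree version applies to U.
  set U : Finset V := {x | x = v ∨ p / 2 * (n : ℝ) ^ (k - 1) ≤ H.tupleDegree x} with hU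
  have hvU : v ∈ U := by simp [hU]
  have hbad := (hd.mono (min_le_right _ _)).card_bad univ
  rw [card_univ, Fintype.card_fun, Fintype.card_fin, ← hn', Nat.cast_pow] at hbad
  have hUcard : (n : ℝ) - Fintype.card U ≤ β * n := by
    have h1 : n - Fintype.card U
        ≤ #{x | (#{y ∈ (univ : Finset (Fin (k - 1) → V)) | H.Hit x y} : ℝ)
            < p / 2 * (n : ℝ) ^ (k - 1)} := by
      rw [Fintype.card_coe, hn', ← card_compl]
      refine card_le_card fun x hx => ?_
      rw [mem_compl, hU, mem_filter] at hx
      rw [mem_filter]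
      refine ⟨mem_univ _, ?_⟩
      by_contra hx'
      exact hx ⟨mem_univ _, Or.inr (not_lt.1 hx')⟩
    have h2 : (n : ℝ) - Fintype.card U ≤ (n - Fintype.card U : ℕ) := by
      rw [Nat.cast_sub]
      rw [Fintype.card_coe]; exact card_le_univ _
    refine h2.trans ((Nat.cast_le.2 h1).trans ?_)
    have h3 : (0 : ℝ) < n ^ (k - 1) := by positivity
    have h4 : (0 : ℝ) < p / 2 * n ^ (k - 1) := by positivity
    refine le_of_mul_le_mul_left ?_ h4
    linarith
  have hUn : 1 / 2 * (n : ℝ) ≤ Fintype.card U := by nlinarith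
  have hUle : (Fintype.card U : ℝ) ≤ n := by
    rw [Fintype.card_coe]; exact_mod_cast card_le_univ _
  have hdeg' : ∀ u : U, γ / 4 * (Fintype.card U : ℝ) ^ (k - 1)
      ≤ (H.pullback (Subtype.val : U → V)).tupleDegree u := by
    intro u
    have h1 := H.tupleDegree_pullback_ge (φ := (Subtype.val : U → V)) Subtype.val_injective
      (β := β) hUcard u
    have h0 : (0 : ℝ) ≤ n ^ (k - 1) := by positivity
    have h2 : γ / 2 * (n : ℝ) ^ (k - 1) ≤ H.tupleDegree (u : V) := by
      rcases (mem_filter.1 u.2).2 with hu | hu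
      · rw [hu]; refine le_trans ?_ hv; gcongr; linarith
      · refine le_trans ?_ hu; gcongr
    have h4 : γ / 4 * (Fintype.card U : ℝ) ^ (k - 1) ≤ γ / 4 * n ^ (k - 1) := by gcongr
    rw [← hn', hkβ] at h1
    linarith
  obtain ⟨g, hg, hgi, w, hw⟩ := h U (H.pullback (Subtype.val : U → V)) (by
      have : (n₁ : ℝ) ≤ Fintype.card U := by
        have : (2 : ℝ) * n₁ ≤ n := by exact_mod_cast hn
        linarith
      exact_mod_cast this) (by
      have := H.relDense_pullback (φ := (Subtype.val : U → V)) Subtype.val_injective hk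
        (by positivity) (c := 1 / 2) (by norm_num) hUn (hd.mono (min_le_left _ _))
      rwa [mul_div_assoc, div_self (by positivity), mul_one] at this) hdeg' ⟨v, hvU⟩
  exact ⟨Subtype.val ∘ g, isHom_pullback_comp hg, Subtype.val_injective.comp hgi, w, by simp [hw]⟩

/-- Every linear-sized vertex set of a dense host contains a copy of `F`. -/
theorem exists_isHom_into (hk : 1 ≤ k) {F : KGraph k W} (hF : F ∈ edgeCOVER k 1 W)
    {p η : ℝ} (hp : 0 < p) (hp1 : p < 1) (hη : 0 < η) :
    ∃ (n₀ : ℕ) (μ : ℝ), 0 < μ ∧ ∀ (V : Type) [Fintype V] (H : KGraph k V),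
      n₀ ≤ Fintype.card V → RelDense H.Hit p μ →
      ∀ U : Finset V, η * Fintype.card V ≤ #U →
      ∃ g : W → V, F.IsHom H g ∧ Function.Injective g ∧ ∀ w, g w ∈ U := by
  obtain ⟨n₁, μ, hμ, h⟩ := exists_isHom_of_tupleDegree hk hF hp hp1 (half_pos hp)
  -- The factor η ^ k cancels the loss from restricting to U, the +1 makes U nonempty, and an error
  -- of p/4 still leaves average degree above p/2 inside U.
  refine ⟨⌈(n₁ + 1) / η⌉₊, min μ (p / 4) * η ^ k, by positivity, ?_⟩
  intro V _ H hn hd U hU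
  have hn2 : (n₁ + 1 : ℝ) ≤ #U := by
    have : (n₁ + 1) / η ≤ Fintype.card V := (Nat.le_ceil _).trans (by exact_mod_cast hn)
    rw [div_le_iff₀ hη] at this
    linarith
  have hd' := H.relDense_pullback (φ := (Subtype.val : U → V)) Subtype.val_injective hk
    (by positivity) hη (by rw [Fintype.card_coe]; exact hU) hd
  rw [mul_div_assoc, div_self (by positivity), mul_one] at hd'
  set N := (Fintype.card U : ℝ) with hN
  have hNU : N = #U := by rw [hN, Fintype.card_coe]
  have hN0 : 0 < N := by rw [hNU]; linarith [(Nat.cast_nonneg n₁ : (0 : ℝ) ≤ n₁)]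
  obtain ⟨u, hu⟩ : ∃ u, p / 2 * N ^ (k - 1)
      ≤ (H.pullback (Subtype.val : U → V)).tupleDegree u := by
    by_contra! hlt
    have h1 := hd'.mono (min_le_right _ _) univ univ
    rw [card_univ, card_univ, Fintype.card_fun, Fintype.card_fin, Nat.cast_pow, ← hN] at h1
    have h2 : ∑ u : U, ((H.pullback (Subtype.val : U → V)).tupleDegree u : ℝ)
        ≤ N * (p / 2 * N ^ (k - 1)) := by
      refine (sum_le_sum fun u _ => (hlt u).le).trans (le_of_eq ?_)
      rw [sum_const, card_univ, nsmul_eq_mul]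
    have h3 : p * N * N ^ (k - 1) - p / 4 * (N * N ^ (k - 1))
        ≤ N * (p / 2 * N ^ (k - 1)) := h1.trans h2
    have h4 : 0 < p * (N * N ^ (k - 1)) := by positivity
    linarith
  obtain ⟨g, hg, hgi, -⟩ := h U (H.pullback (Subtype.val : U → V)) (by
      have : (n₁ : ℝ) ≤ Fintype.card U := by linarith
      exact_mod_cast this) (hd'.mono (min_le_left _ _)) u hu
  exact ⟨Subtype.val ∘ g, isHom_pullback_comp hg, Subtype.val_injective.comp hgi,
    fun w => (g w).2⟩

end KGraph

/-! ### Supersaturation by sampling with a prescribed root link. -/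

namespace KGraph

open Finset
open scoped Classical

variable {k : ℕ} {U V W : Type*}

/-- The `k`-graph on `U` sampled along `φ : U → V`: edges through the root `u₀` come from the
prescribed link `L`, all others from `H`. -/
noncomputable def rooted [Fintype U] (H : KGraph k V) (L : Finset V → Prop) (u₀ : U) (φ : U → V) :
    KGraph k U where
  edges := {e | #e = k ∧ (u₀ ∈ e → L ((e.erase u₀).image φ)) ∧ (u₀ ∉ e → e.image φ ∈ H.edges)}
  card_eq e he := by simpa using (mem_filter.1 he).2.1

/-- `S` maps the edges of `F` avoiding `ρ` to edges of `H`, and those through `ρ`, with `ρ`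
removed, into `L`. The value `S ρ` plays no role. -/
def IsRootedHom (F : KGraph k W) (H : KGraph k V) (L : Finset V → Prop) (ρ : W) (S : W → V) :
    Prop :=
  ∀ e ∈ F.edges, (ρ ∈ e → L ((e.erase ρ).image S)) ∧ (ρ ∉ e → e.image S ∈ H.edges)

theorem isRootedHom_comp [Fintype U] {F : KGraph k W} {H : KGraph k V} {L : Finset V → Prop}
    {φ : U → V} {g : W → U} (hg : Function.Injective g) {ρ : W}
    (h : F.IsHom (H.rooted L (g ρ) φ) g) : F.IsRootedHom H L ρ (φ ∘ g) := by
  intro e he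
  obtain ⟨-, -, h1, h2⟩ := mem_filter.1 (h e he)
  have hmem : g ρ ∈ e.image g ↔ ρ ∈ e := by simp [hg.eq_iff]
  rw [hmem] at h1 h2
  constructor
  · intro hρ
    have := h1 hρ
    rwa [← image_erase hg, image_image] at this
  · intro hρ
    have := h2 hρ
    rwa [image_image] at this

/-- The tuple `c` spans no edge of `G` between its `q` vertices and its `r` many
`(k-1)`-tuples. -/
def Missed (G : KGraph k U) (q r : ℕ) (c : Fin q ⊕ Fin r × Fin (k - 1) → U) : Prop :=
  ∀ i j, ¬ G.Hit (c (Sum.inl i)) (fun l => c (Sum.inr (j, l)))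

theorem sum_card_avoid_pow [Fintype V] (H : KGraph k V) (q r : ℕ) :
    ∑ Q : Fin q → V, #(avoid H.Hit Q) ^ r = #{c | H.Missed q r c} := by
  have h1 : ∀ Q : Fin q → V, #(avoid H.Hit Q) ^ r
      = #(Fintype.piFinset fun _ : Fin r => avoid H.Hit Q) := by
    intro Q; simp [Fintype.card_piFinset]
  simp only [h1]
  rw [← card_sigma]
  let e : (Fin q ⊕ Fin r × Fin (k - 1) → V) ≃ (Σ _ : Fin q → V, Fin r → Fin (k - 1) → V) :=
    (Equiv.sumArrowEquivProdArrow _ _ _).trans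
      ((Equiv.prodCongr (Equiv.refl _) (Equiv.curry _ _ _)).trans (Equiv.sigmaEquivProd _ _).symm)
  symm
  refine card_equiv e fun c => ?_
  rw [mem_filter, mem_sigma]
  simp only [mem_univ, true_and, Fintype.mem_piFinset, avoid, mem_filter]
  exact forall_comm

/-- The tuples that are injective and avoid `u₀`. -/
def IsGeneric {J : Type*} (u₀ : U) (c : J → U) : Prop := Function.Injective c ∧ ∀ j, c j ≠ u₀

theorem card_not_isGeneric_le {J : Type*} [Fintype J] [DecidableEq J] [Fintype U] (u₀ : U)
    {κ : ℝ} (hκ : ((Fintype.card J : ℝ) ^ 2 + Fintype.card J) ≤ κ * Fintype.card U) :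
    (#{c : J → U | ¬ IsGeneric u₀ c} : ℝ) ≤ κ * Fintype.card U ^ Fintype.card J := by
  have hU : (0 : ℝ) < Fintype.card U := by exact_mod_cast Fintype.card_pos_iff.2 ⟨u₀⟩
  have h1 : (#{c : J → U | ¬ Function.Injective c} : ℝ) * Fintype.card U
      ≤ Fintype.card J ^ 2 * Fintype.card U ^ Fintype.card J := by
    exact_mod_cast card_not_injective_le (J := J) (V := U)
  have h2 := card_exists_mem_le (J := J) (V := U) (fun _ => {u₀}) (b := 1) (by simp)
  have h3 : #{c : J → U | ¬ IsGeneric u₀ c} ≤ #{c : J → U | ¬ Function.Injective c}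
      + #{c : J → U | ∃ j, c j ∈ ({u₀} : Finset U)} := by
    refine (card_le_card fun c hc => ?_).trans (card_union_le _ _)
    simp only [mem_filter, mem_univ, true_and, IsGeneric, not_and, not_forall, not_not,
      mem_union, mem_singleton] at hc ⊢
    exact or_iff_not_imp_left.2 fun h => hc (not_not.1 h)
  have h3' : (#{c : J → U | ¬ IsGeneric u₀ c} : ℝ) ≤ #{c : J → U | ¬ Function.Injective c}
      + #{c : J → U | ∃ j, c j ∈ ({u₀} : Finset U)} := by exact_mod_cast h3
  refine le_of_mul_le_mul_right ?_ hU
  calc _ ≤ (#{c : J → U | ¬ Function.Injective c}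
      + #{c : J → U | ∃ j, c j ∈ ({u₀} : Finset U)} : ℝ) * Fintype.card U := by gcongr
    _ ≤ ((Fintype.card J : ℝ) ^ 2 + Fintype.card J) * Fintype.card U ^ Fintype.card J := by
      linarith
    _ ≤ κ * Fintype.card U * Fintype.card U ^ Fintype.card J := by gcongr
    _ = _ := by ring

theorem rooted_hit_iff [Fintype U] (H : KGraph k V) (L : Finset V → Prop) {u₀ : U} (φ : U → V)
    (hk : 1 ≤ k) {x : U} {y : Fin (k - 1) → U} (hy : Function.Injective y) (hx : ∀ l, y l ≠ x)
    (hx0 : x ≠ u₀) (hy0 : ∀ l, y l ≠ u₀) :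
    (H.rooted L u₀ φ).Hit x y ↔ H.Hit (φ x) (φ ∘ y) := by
  have h1 : #(insert x (univ.image y)) = k := by
    rw [card_insert_of_notMem (by simpa using hx), card_image_of_injective _ hy, card_univ,
      Fintype.card_fin]
    omega
  have h2 : u₀ ∉ insert x (univ.image y) := by
    simp only [mem_insert, mem_image, mem_univ, true_and, not_or, not_exists]
    exact ⟨hx0.symm, hy0⟩
  unfold Hit rooted
  simp only [mem_filter, mem_univ, true_and, h1, h2, not_false_eq_true, IsEmpty.forall_iff,
    forall_const, image_insert, image_image]

/-- Sum over the pattern positions c first. For c injective and avoiding the root, φ ∘ c is a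
uniformly random pattern in V and the root link is irrelevant, so the host's proportion τ appears.
The remaining c have proportion at most κ. -/
theorem sum_card_missed_rooted_le [Fintype U] [Fintype V] [Nonempty V] (H : KGraph k V)
    (L : Finset V → Prop) (u₀ : U) (hk : 1 ≤ k) (q r : ℕ) {κ τ : ℝ} (hτ : 0 ≤ τ)
    (hκ : ((q + r * (k - 1 : ℕ) : ℕ) : ℝ) ^ 2 + (q + r * (k - 1 : ℕ) : ℕ) ≤ κ * Fintype.card U)
    (hH : (#{c | H.Missed q r c} : ℝ) ≤ τ * Fintype.card V ^ (q + r * (k - 1))) :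
    ∑ φ : U → V, (#{c | (H.rooted L u₀ φ).Missed q r c} : ℝ)
      ≤ Fintype.card V ^ Fintype.card U * ((τ + κ) * Fintype.card U ^ (q + r * (k - 1))) := by
  set J := Fin q ⊕ Fin r × Fin (k - 1) with hJ
  have hJc : Fintype.card J = q + r * (k - 1) := by simp [hJ]
  have hn : (0 : ℝ) < Fintype.card V := by exact_mod_cast Fintype.card_pos
  have hswap : ∑ φ : U → V, (#{c | (H.rooted L u₀ φ).Missed q r c} : ℝ)
      = ∑ c : J → U, (#{φ : U → V | (H.rooted L u₀ φ).Missed q r c} : ℝ) := by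
    exact_mod_cast sum_card_bipartiteAbove_eq_sum_card_bipartiteBelow
      (s := (univ : Finset (U → V))) (t := (univ : Finset (J → U)))
      (fun φ c => (H.rooted L u₀ φ).Missed q r c)
  rw [hswap, ← sum_filter_add_sum_filter_not univ (IsGeneric u₀)]
  have hgood : ∀ c : J → U, IsGeneric u₀ c →
      (#{φ : U → V | (H.rooted L u₀ φ).Missed q r c} : ℝ)
        ≤ τ * Fintype.card V ^ Fintype.card U := by
    intro c hc
    have h1 : ∀ φ : U → V, (H.rooted L u₀ φ).Missed q r c ↔ H.Missed q r (φ ∘ c) := by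
      intro φ
      refine forall_congr' fun i => forall_congr' fun j => not_congr ?_
      refine rooted_hit_iff H L φ hk ?_ ?_ (hc.2 _) fun l => hc.2 _
      · intro l l' hl
        exact (Prod.mk.inj (Sum.inr.inj (hc.1 hl))).2
      · intro l hl
        exact Sum.inr_ne_inl (hc.1 hl)
    have h2 := card_comp_injective (V := V) hc.1 (fun g => H.Missed q r g)
    rw [hJc] at h2
    simp only [h1]
    have h3 : (#{φ : U → V | H.Missed q r (φ ∘ c)} : ℝ) * Fintype.card V ^ (q + r * (k - 1))
        = #{c | H.Missed q r c} * Fintype.card V ^ Fintype.card U := by exact_mod_cast h2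
    refine le_of_mul_le_mul_right ?_ (pow_pos hn (q + r * (k - 1)))
    rw [h3]
    calc _ ≤ τ * (Fintype.card V : ℝ) ^ (q + r * (k - 1)) * Fintype.card V ^ Fintype.card U := by
          gcongr
      _ = _ := by ring
  have hbad := card_not_isGeneric_le (J := J) u₀ (κ := κ) (by rw [hJc]; exact hκ)
  rw [hJc] at hbad
  have h4 : ∑ c : J → U with IsGeneric u₀ c,
      (#{φ : U → V | (H.rooted L u₀ φ).Missed q r c} : ℝ)
      ≤ Fintype.card U ^ (q + r * (k - 1)) * (τ * Fintype.card V ^ Fintype.card U) := by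
    calc _ ≤ ∑ c : J → U with IsGeneric u₀ c, τ * (Fintype.card V : ℝ) ^ Fintype.card U :=
          sum_le_sum fun c hc => hgood c (mem_filter.1 hc).2
      _ ≤ ∑ c : J → U, τ * (Fintype.card V : ℝ) ^ Fintype.card U :=
          sum_le_sum_of_subset_of_nonneg (filter_subset _ _) fun _ _ _ => by positivity
      _ = _ := by
        rw [sum_const, card_univ, Fintype.card_fun, hJc, nsmul_eq_mul, Nat.cast_pow]
  have h5 : ∑ c : J → U with ¬ IsGeneric u₀ c,
      (#{φ : U → V | (H.rooted L u₀ φ).Missed q r c} : ℝ)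
      ≤ κ * Fintype.card U ^ (q + r * (k - 1)) * Fintype.card V ^ Fintype.card U := by
    calc _ ≤ ∑ c : J → U with ¬ IsGeneric u₀ c, (Fintype.card V : ℝ) ^ Fintype.card U := by
          refine sum_le_sum fun c _ => ?_
          exact_mod_cast (card_le_univ _).trans_eq Fintype.card_fun
      _ = #{c : J → U | ¬ IsGeneric u₀ c} * (Fintype.card V : ℝ) ^ Fintype.card U := by
        rw [sum_const, nsmul_eq_mul]
      _ ≤ _ := by gcongr
  linarith

/-- A generic tuple of sample positions is mapped to a uniformly random tuple of V, which meets L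
with probability at least α. At least 3/4 of the tuples are generic. -/
theorem le_sum_tupleDegree_rooted [Fintype U] [Fintype V] [Nonempty V] (H : KGraph k V)
    (L : Finset V → Prop) (u₀ : U) (hk : 1 ≤ k) {α : ℝ} (hα : 0 ≤ α)
    (hU : 4 * ((k : ℝ) ^ 2 + k) ≤ Fintype.card U)
    (hL : α * Fintype.card V ^ (k - 1) ≤ #{y : Fin (k - 1) → V | L (univ.image y)}) :
    Fintype.card V ^ Fintype.card U * (3 / 4 * α * Fintype.card U ^ (k - 1))
      ≤ ∑ φ : U → V, ((H.rooted L u₀ φ).tupleDegree u₀ : ℝ) := by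
  have hn : (0 : ℝ) < Fintype.card V := by exact_mod_cast Fintype.card_pos
  have hswap : ∑ φ : U → V, ((H.rooted L u₀ φ).tupleDegree u₀ : ℝ)
      = ∑ y : Fin (k - 1) → U, (#{φ : U → V | (H.rooted L u₀ φ).Hit u₀ y} : ℝ) := by
    exact_mod_cast sum_card_bipartiteAbove_eq_sum_card_bipartiteBelow
      (s := (univ : Finset (U → V))) (t := (univ : Finset (Fin (k - 1) → U)))
      (fun φ y => (H.rooted L u₀ φ).Hit u₀ y)
  rw [hswap]
  have hgood : ∀ y : Fin (k - 1) → U, IsGeneric u₀ y →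
      α * Fintype.card V ^ Fintype.card U
        ≤ (#{φ : U → V | (H.rooted L u₀ φ).Hit u₀ y} : ℝ) := by
    intro y hy
    have h2 := card_comp_injective (V := V) hy.1 (fun g => L (univ.image g))
    rw [Fintype.card_fin] at h2
    have h3 : (#{φ : U → V | L (univ.image (φ ∘ y))} : ℝ) * Fintype.card V ^ (k - 1)
        = #{y : Fin (k - 1) → V | L (univ.image y)} * Fintype.card V ^ Fintype.card U := by
      exact_mod_cast h2
    have h4 : #{φ : U → V | L (univ.image (φ ∘ y))}
        ≤ #{φ : U → V | (H.rooted L u₀ φ).Hit u₀ y} := by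
      refine card_le_card fun φ hφ => ?_
      rw [mem_filter] at hφ ⊢
      have hu : u₀ ∉ univ.image y := by simpa using hy.2
      have hc : #(insert u₀ (univ.image y)) = k := by
        rw [card_insert_of_notMem hu, card_image_of_injective _ hy.1, card_univ, Fintype.card_fin]
        omega
      refine ⟨mem_univ _, mem_filter.2 ⟨mem_univ _, hc, fun _ => ?_, fun h => ?_⟩⟩
      · rw [erase_insert hu, image_image]
        exact hφ.2
      · exact absurd (mem_insert_self _ _) h
    refine le_trans ?_ (Nat.cast_le.2 h4)
    refine le_of_mul_le_mul_right ?_ (pow_pos hn (k - 1))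
    rw [h3]
    calc _ = α * (Fintype.card V : ℝ) ^ (k - 1) * Fintype.card V ^ Fintype.card U := by ring
      _ ≤ _ := by gcongr
  have hbad := card_not_isGeneric_le (J := Fin (k - 1)) u₀ (κ := 1 / 4) (by
    have : ((k - 1 : ℕ) : ℝ) ≤ k := by exact_mod_cast Nat.sub_le _ _
    have h2 : ((k - 1 : ℕ) : ℝ) ^ 2 ≤ (k : ℝ) ^ 2 := by gcongr
    rw [Fintype.card_fin]
    linarith)
  rw [Fintype.card_fin] at hbad
  have hcount : (#{y : Fin (k - 1) → U | IsGeneric u₀ y} : ℝ)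
      + #{y : Fin (k - 1) → U | ¬ IsGeneric u₀ y} = Fintype.card U ^ (k - 1) := by
    have := card_filter_add_card_filter_not (s := (univ : Finset (Fin (k - 1) → U))) (IsGeneric u₀)
    rw [card_univ, Fintype.card_fun, Fintype.card_fin] at this
    exact_mod_cast this
  calc _ ≤ #{y : Fin (k - 1) → U | IsGeneric u₀ y} * (α * Fintype.card V ^ Fintype.card U) := by
        have h1 : 3 / 4 * (Fintype.card U : ℝ) ^ (k - 1)
            ≤ #{y : Fin (k - 1) → U | IsGeneric u₀ y} := by linarith
        have h2 : 0 ≤ α * (Fintype.card V : ℝ) ^ Fintype.card U := by positivity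
        have := mul_le_mul_of_nonneg_right h1 h2
        linarith
    _ = ∑ y : Fin (k - 1) → U with IsGeneric u₀ y, α * (Fintype.card V : ℝ) ^ Fintype.card U := by
        rw [sum_const, nsmul_eq_mul]
    _ ≤ ∑ y : Fin (k - 1) → U with IsGeneric u₀ y,
          (#{φ : U → V | (H.rooted L u₀ φ).Hit u₀ y} : ℝ) :=
        sum_le_sum fun y hy => hgood y (mem_filter.1 hy).2
    _ ≤ _ := sum_le_sum_of_subset_of_nonneg (filter_subset _ _) fun _ _ _ => by positivity

/-- Many samples have a root of large degree and miss few complete bipartite patterns. -/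
theorem card_good_samples_ge [Fintype U] [Fintype V] [Nonempty V] (H : KGraph k V)
    (L : Finset V → Prop) (u₀ : U) (hk : 1 ≤ k) (q r : ℕ) {α κ τ θ : ℝ} (hα : 0 ≤ α)
    (hτ : 0 ≤ τ) (hθ : 0 < θ) (hτκ : τ + κ ≤ α / 8 * θ)
    (hκ : ((q + r * (k - 1 : ℕ) : ℕ) : ℝ) ^ 2 + (q + r * (k - 1 : ℕ) : ℕ) ≤ κ * Fintype.card U)
    (hU : 4 * ((k : ℝ) ^ 2 + k) ≤ Fintype.card U)
    (hH : (#{c | H.Missed q r c} : ℝ) ≤ τ * Fintype.card V ^ (q + r * (k - 1)))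
    (hL : α * Fintype.card V ^ (k - 1) ≤ #{y : Fin (k - 1) → V | L (univ.image y)}) :
    α / 8 * Fintype.card V ^ Fintype.card U
      ≤ #{φ : U → V | α / 2 * Fintype.card U ^ (k - 1) ≤ (H.rooted L u₀ φ).tupleDegree u₀ ∧
          (#{c | (H.rooted L u₀ φ).Missed q r c} : ℝ)
            < θ * Fintype.card U ^ (q + r * (k - 1))} := by
  have hm : (0 : ℝ) < Fintype.card U := by exact_mod_cast Fintype.card_pos_iff.2 ⟨u₀⟩
  have h1 := sum_card_missed_rooted_le H L u₀ hk q r hτ hκ hH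
  have h2 := le_sum_tupleDegree_rooted H L u₀ hk hα hU hL
  set m := (Fintype.card U : ℝ) with hmdef
  set N := (Fintype.card V : ℝ) ^ Fintype.card U with hN
  set s := q + r * (k - 1)
  have hN0 : 0 ≤ N := by positivity
  set G : Finset (U → V) := {φ : U → V | α / 2 * m ^ (k - 1) ≤ (H.rooted L u₀ φ).tupleDegree u₀ ∧
          (#{c | (H.rooted L u₀ φ).Missed q r c} : ℝ) < θ * m ^ s} with hG
  -- Two-event Markov in one line: normalised root degree ≤ 1_G + α/2 + (missed count)/(θ m ^ s).
  -- Averaging gives 3α/4 ≤ P(G) + α/2 + α/8.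
  have hpt : ∀ φ : U → V, ((H.rooted L u₀ φ).tupleDegree u₀ : ℝ)
      ≤ m ^ (k - 1) * ((if φ ∈ G then 1 else 0) + α / 2
        + (θ * m ^ s)⁻¹ * #{c | (H.rooted L u₀ φ).Missed q r c}) := by
    intro φ
    have hD : ((H.rooted L u₀ φ).tupleDegree u₀ : ℝ) ≤ m ^ (k - 1) := by
      have : (H.rooted L u₀ φ).tupleDegree u₀ ≤ Fintype.card U ^ (k - 1) := by
        refine (card_le_univ _).trans_eq ?_
        rw [Fintype.card_fun, Fintype.card_fin]
      rw [hmdef]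
      exact_mod_cast this
    have hT : 0 ≤ (θ * m ^ s)⁻¹ * (#{c | (H.rooted L u₀ φ).Missed q r c} : ℝ) := by positivity
    have hm' : 0 < m ^ (k - 1) := by positivity
    split_ifs with hφ
    · refine hD.trans (le_mul_of_one_le_right hm'.le ?_)
      linarith
    · rw [hG, mem_filter, not_and, not_and_or, not_le, not_lt] at hφ
      rcases hφ (mem_univ _) with h | h
      · have := mul_nonneg hm'.le hT
        linarith
      · refine hD.trans (le_mul_of_one_le_right hm'.le ?_)
        have : 1 ≤ (θ * m ^ s)⁻¹ * (#{c | (H.rooted L u₀ φ).Missed q r c} : ℝ) := by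
          rw [inv_mul_eq_div, one_le_div (by positivity)]
          exact h
        linarith
  have hsum := sum_le_sum fun (φ : U → V) (_ : φ ∈ univ) => hpt φ
  rw [← mul_sum, sum_add_distrib, sum_add_distrib, ← mul_sum] at hsum
  simp only [sum_ite_mem, univ_inter, sum_const, nsmul_eq_mul, mul_one, card_univ,
    Fintype.card_fun, Nat.cast_pow] at hsum
  rw [← hN] at hsum
  have h3 : (θ * m ^ s)⁻¹ * ∑ φ : U → V, (#{c | (H.rooted L u₀ φ).Missed q r c} : ℝ)
      ≤ N * (α / 8) := by
    rw [inv_mul_le_iff₀ (by positivity)]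
    refine h1.trans ?_
    calc _ ≤ N * (α / 8 * θ * m ^ s) := by gcongr
      _ = _ := by ring
  have h4 : m ^ (k - 1) * (N * (3 / 4 * α)) ≤ m ^ (k - 1) * (#G + N * (α / 2) + N * (α / 8)) := by
    calc _ = N * (3 / 4 * α * m ^ (k - 1)) := by ring
      _ ≤ _ := h2
      _ ≤ _ := hsum
      _ ≤ _ := by gcongr
  have h5 := le_of_mul_le_mul_left h4 (by positivity)
  linarith

/-- Pigeonhole over the pairs (root ρ, injection g : W → U). As g is injective, φ ∘ g is uniform in
W → V, so the proportion of φ that succeed with g is at most the proportion of rooted homomorphisms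
S. -/
theorem exists_card_isRootedHom_ge_of_sample [Fintype U] [Fintype V] [Nonempty V] [Fintype W]
    (F : KGraph k W) (H : KGraph k V) (L : Finset V → Prop) (u₀ : U) {c : ℝ}
    (hc : 0 < c) (G : Finset (U → V))
    (hG : c * Fintype.card V ^ Fintype.card U ≤ #G)
    (hcopy : ∀ φ ∈ G, ∃ g : W → U, F.IsHom (H.rooted L u₀ φ) g ∧ Function.Injective g ∧
      u₀ ∈ Set.range g) :
    ∃ ρ, c / (Fintype.card W * Fintype.card U ^ Fintype.card W)
        * Fintype.card V ^ Fintype.card W ≤ #{S | F.IsRootedHom H L ρ S} := by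
  have hn : (0 : ℝ) < Fintype.card V := by exact_mod_cast Fintype.card_pos
  have hGne : G.Nonempty := by
    rw [← card_pos]
    have : (0 : ℝ) < #G := lt_of_lt_of_le (by positivity) hG
    exact_mod_cast this
  have hm : (0 : ℝ) < Fintype.card U := by exact_mod_cast Fintype.card_pos_iff.2 ⟨u₀⟩
  have hf : (0 : ℝ) < Fintype.card W := by
    obtain ⟨φ, hφ⟩ := hGne
    obtain ⟨g, -, -, w, -⟩ := hcopy φ hφ
    exact_mod_cast Fintype.card_pos_iff.2 ⟨w⟩
  by_contra! hlt
  have : Nonempty W := Fintype.card_pos_iff.1 (by exact_mod_cast hf)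
  set c' := c / (Fintype.card W * (Fintype.card U : ℝ) ^ Fintype.card W) with hc'
  set P : Finset (W × (W → U)) := {x | Function.Injective x.2} with hP
  have h1 : #G ≤ ∑ x ∈ P, #{φ : U → V | F.IsRootedHom H L x.1 (φ ∘ x.2)} := by
    refine (card_le_card fun φ hφ => ?_).trans card_biUnion_le
    obtain ⟨g, hg, hgi, ρ, hρ⟩ := hcopy φ hφ
    refine mem_biUnion.2 ⟨(ρ, g), by simpa [hP] using hgi, mem_filter.2 ⟨mem_univ _, ?_⟩⟩
    subst hρ
    exact isRootedHom_comp hgi hg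
  have hpt : ∀ x ∈ P, (#{φ : U → V | F.IsRootedHom H L x.1 (φ ∘ x.2)} : ℝ)
      < c' * Fintype.card V ^ Fintype.card U := by
    intro x hx
    have h2 : (#{φ : U → V | F.IsRootedHom H L x.1 (φ ∘ x.2)} : ℝ)
        * Fintype.card V ^ Fintype.card W
        = #{S | F.IsRootedHom H L x.1 S} * Fintype.card V ^ Fintype.card U := by
      exact_mod_cast card_comp_injective (V := V) (mem_filter.1 hx).2
        (fun S => F.IsRootedHom H L x.1 S)
    refine lt_of_mul_lt_mul_right ?_ (pow_nonneg hn.le (Fintype.card W))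
    rw [h2]
    calc _ < c' * Fintype.card V ^ Fintype.card W * (Fintype.card V : ℝ) ^ Fintype.card U := by
          have := hlt x.1
          gcongr
      _ = _ := by ring
  have hPne : P.Nonempty := by
    rw [nonempty_iff_ne_empty]
    intro h0
    rw [h0, sum_empty] at h1
    exact absurd hGne.card_pos (by omega)
  have hPc : (#P : ℝ) ≤ Fintype.card W * (Fintype.card U : ℝ) ^ Fintype.card W := by
    have : #P ≤ Fintype.card W * Fintype.card U ^ Fintype.card W :=
      (card_le_univ _).trans_eq (by rw [Fintype.card_prod, Fintype.card_fun])
    exact_mod_cast this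
  have h3 : (#G : ℝ) < #P * (c' * Fintype.card V ^ Fintype.card U) := by
    calc (#G : ℝ) ≤ ∑ x ∈ P, (#{φ : U → V | F.IsRootedHom H L x.1 (φ ∘ x.2)} : ℝ) := by
          exact_mod_cast h1
      _ < ∑ x ∈ P, c' * (Fintype.card V : ℝ) ^ Fintype.card U := sum_lt_sum_of_nonempty hPne hpt
      _ = _ := by rw [sum_const, nsmul_eq_mul]
  have h4 : #P * (c' * (Fintype.card V : ℝ) ^ Fintype.card U)
      ≤ c * (Fintype.card V : ℝ) ^ Fintype.card U := by
    rw [← mul_assoc]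
    gcongr
    rw [hc', mul_div_assoc', div_le_iff₀ (by positivity), mul_comm]
    gcongr
  linarith

/-- The decay b ^ (q * q) is exponential in q ^ 2 and beats ν ^ (2 * q), which is exponential only
in q. -/
theorem exists_pow_sq_le {b κ ν : ℝ} (hb : 0 < b) (hb1 : b < 1) (hκ : 0 < κ) (hν : 0 < ν) :
    ∃ q : ℕ, (q + 1) * b ^ (q * q) ≤ κ * ν ^ (q + q) := by
  have hκ' : 0 < min κ 1 := by positivity
  obtain ⟨q, hq⟩ := exists_pow_lt_of_lt_one (y := b) (x := min κ 1 * ν ^ 2 / 2)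
    (by positivity) hb1
  have hq' : b ^ (q + 1) ≤ min κ 1 * ν ^ 2 / 2 :=
    (pow_le_pow_of_le_one hb.le hb1.le (Nat.le_succ q)).trans hq.le
  refine ⟨q + 1, ?_⟩
  set Q := q + 1 with hQ
  have h1 : ((Q : ℝ) + 1) ≤ 2 ^ Q := by exact_mod_cast Nat.lt_two_pow_self
  calc ((Q : ℝ) + 1) * b ^ (Q * Q) ≤ 2 ^ Q * b ^ (Q * Q) := by gcongr
    _ = (2 * b ^ Q) ^ Q := by rw [mul_pow, pow_mul]
    _ ≤ (min κ 1 * ν ^ 2) ^ Q := pow_le_pow_left₀ (by positivity) (by linarith) _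
    _ = (min κ 1) ^ Q * ν ^ (Q + Q) := by rw [mul_pow, ← pow_mul]; ring
    _ ≤ min κ 1 * ν ^ (Q + Q) := by
      gcongr
      exact pow_le_of_le_one hκ'.le (min_le_right _ _) (by omega)
    _ ≤ _ := by gcongr; exact min_le_left _ _

/-- Supersaturation: in a dense host, every positive-density link supports a positive proportion
of rooted homomorphisms from a suitably rooted `F`. -/
theorem exists_card_isRootedHom_ge [Fintype W] (hk : 1 ≤ k) {F : KGraph k W}
    (hF : F ∈ edgeCOVER k 1 W) {p α : ℝ} (hp : 0 < p) (hp1 : p < 1) (hα : 0 < α) :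
    ∃ μ c : ℝ, 0 < μ ∧ 0 < c ∧ ∀ (V : Type) [Fintype V] [Nonempty V] (H : KGraph k V)
      (L : Finset V → Prop), RelDense H.Hit p μ →
      α * Fintype.card V ^ (k - 1) ≤ #{y : Fin (k - 1) → V | L (univ.image y)} →
      ∃ ρ, c * Fintype.card V ^ Fintype.card W ≤ #{S | F.IsRootedHom H L ρ S} := by
  obtain ⟨n₁, ν, hν, h⟩ := exists_isHom_of_tupleDegree hk hF (p := p / 4) (α := α / 2)
    (by positivity) (by linarith) (by positivity)
  have h4 : 0 < 1 - p / 4 := by linarith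
  have h2 : 0 < 1 - p / 2 := by linarith
  -- A p-dense host misses roughly a (1 - p/2) ^ (q * q) share of patterns, while a sample that is
  -- not (p/4, ν)-dense misses at least θ. The gap between p/2 and p/4 makes the former negligible
  -- for suitable q.
  obtain ⟨q, hq⟩ := exists_pow_sq_le (b := (1 - p / 2) / (1 - p / 4)) (κ := α / 32) (ν := ν)
    (by positivity) (by rw [div_lt_one h4]; linarith) (by positivity) hν
  set θ := ν ^ (q + q) * (1 - p / 4) ^ (q * q) with hθ
  have hθ0 : 0 < θ := by positivity
  have hq' : (q + 1) * (1 - p / 2) ^ (q * q) ≤ α / 32 * θ := by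
    rw [div_pow, mul_div_assoc', div_le_iff₀ (by positivity)] at hq
    rw [hθ]; linarith
  set δ := (1 - p / 2) ^ q with hδ
  have hδ0 : 0 < δ := by positivity
  -- Chosen so that both parts of τ are at most α θ / 32; then τ and κ are each at most α θ / 16.
  set μ := p * δ * (α / 32 * θ) / (2 * (q + 1)) with hμ
  have hμ0 : 0 < μ := by positivity
  set τ := (1 - p / 2) ^ (q * q) + q * (2 * μ / (p * δ) + δ ^ q) with hτ
  have hτ0 : 0 ≤ τ := by positivity
  have hτle : τ ≤ α / 16 * θ := by
    have e1 : 2 * μ / (p * δ) = α / 32 * θ / (q + 1) := by rw [hμ]; field_simp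
    have e2 : (q : ℝ) * (α / 32 * θ / (q + 1)) ≤ α / 32 * θ := by
      rw [mul_div_assoc', div_le_iff₀ (by positivity)]
      have : 0 < α / 32 * θ := by positivity
      linarith
    have e3 : δ ^ q = (1 - p / 2) ^ (q * q) := by rw [hδ, ← pow_mul]
    rw [hτ, e1, e3]
    linarith
  set s := q + q * (k - 1) with hs
  set κ := α / 16 * θ with hκ
  have hκ0 : 0 < κ := by positivity
  -- The summands serve the cover threshold, the generic root tuples and the generic patterns.
  set m := n₁ + 4 * (k ^ 2 + k) + ⌈((s : ℝ) ^ 2 + s) / κ⌉₊ with hm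
  have hk2 : 0 < m := by have : 0 < k ^ 2 := by positivity
                         omega
  have : NeZero m := ⟨hk2.ne'⟩
  -- The +1 keeps the denominator positive even if W is empty.
  refine ⟨μ, α / 8 / (Fintype.card W * (m : ℝ) ^ Fintype.card W + 1), hμ0, by positivity, ?_⟩
  intro V _ _ H L hd hL
  have hmiss : (#{c | H.Missed q q c} : ℝ) ≤ τ * Fintype.card V ^ (q + q * (k - 1)) := by
    have e1 := hd.sum_avoid_le hp hp1 hμ0.le hδ0 q q
    simp only [div_pow] at e1
    rw [← sum_div, div_le_iff₀ (by rw [Fintype.card_fun]; positivity)] at e1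
    have e2 : (#{c | H.Missed q q c} : ℝ) = ∑ Q : Fin q → V, (#(avoid H.Hit Q) : ℝ) ^ q := by
      exact_mod_cast (sum_card_avoid_pow H q q).symm
    rw [e2]
    refine e1.trans (le_of_eq ?_)
    rw [hτ, Fintype.card_fun, Fintype.card_fin, Nat.cast_pow,
      ← pow_mul (Fintype.card V : ℝ) (k - 1) q, pow_add, mul_comm (k - 1) q]
    ring
  have hcard : ((s : ℝ) ^ 2 + s) ≤ κ * Fintype.card (Fin m) := by
    rw [Fintype.card_fin, mul_comm, ← div_le_iff₀ hκ0]
    exact (Nat.le_ceil _).trans (Nat.cast_le.2 (by omega))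
  have hgood := card_good_samples_ge H L (0 : Fin m) hk q q hα.le hτ0 hθ0 (κ := κ)
    (by linarith) hcard (by
      rw [Fintype.card_fin]
      exact_mod_cast (by omega : 4 * (k ^ 2 + k) ≤ m)) hmiss hL
  obtain ⟨ρ, hρ⟩ := exists_card_isRootedHom_ge_of_sample F H L (0 : Fin m) (c := α / 8)
    (by positivity) _ hgood (by
    intro φ hφ
    obtain ⟨-, hφ1, hφ2⟩ := mem_filter.1 hφ
    refine h (Fin m) _ (by rw [Fintype.card_fin]; omega) ?_ _ hφ1
    refine relDense_of_sum_avoid_lt (by linarith) hν q q ?_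
    have e2 : (#{c | (H.rooted L (0 : Fin m) φ).Missed q q c} : ℝ)
        = ∑ Q : Fin q → Fin m, (#(avoid (H.rooted L (0 : Fin m) φ).Hit Q) : ℝ) ^ q := by
      exact_mod_cast (sum_card_avoid_pow (H.rooted L (0 : Fin m) φ) q q).symm
    have e3 : (Fintype.card (Fin m) : ℝ) ^ q * (Fintype.card (Fin (k - 1) → Fin m) : ℝ) ^ q
        = (Fintype.card (Fin m) : ℝ) ^ (q + q * (k - 1)) := by
      rw [Fintype.card_fun (α := Fin (k - 1)), Fintype.card_fin (k - 1), Nat.cast_pow, ← pow_mul,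
        pow_add, mul_comm (k - 1) q]
    rw [e3]
    convert hφ2 using 1
    rw [e2])
  refine ⟨ρ, le_trans ?_ hρ⟩
  rw [Fintype.card_fin]
  have : Nonempty W := ⟨ρ⟩
  have hW : (0 : ℝ) < Fintype.card W := by exact_mod_cast Fintype.card_pos
  gcongr
  linarith

end KGraph

/-! ### Absorbing matrices. -/

namespace KGraph

open Finset
open scoped Classical

variable {k : ℕ} {V W : Type*}

theorem IsRootedHom.isHom_update {F : KGraph k W} {H : KGraph k V} {L : Finset V → Prop} {ρ : W}
    {S : W → V} (h : F.IsRootedHom H L ρ S) {x : V} (hL : ∀ s, L s → insert x s ∈ H.edges) :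
    F.IsHom H (Function.update S ρ x) := by
  intro e he
  have hcongr : ∀ e' : Finset W, ρ ∉ e' → e'.image (Function.update S ρ x) = e'.image S := by
    intro e' h'
    refine image_congr fun w hw => ?_
    have : w ≠ ρ := fun hwρ => h' (hwρ ▸ hw)
    simp [this]
  by_cases hρ : ρ ∈ e
  · have h1 := hL _ ((h e he).1 hρ)
    have h2 : e.image (Function.update S ρ x) = insert x ((e.erase ρ).image S) := by
      conv_lhs => rw [← insert_erase hρ, image_insert, Function.update_self,
        hcongr _ (notMem_erase _ _)]
    rwa [h2]
  · rw [hcongr e hρ]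
    exact (h e he).2 hρ

/-- All rows of the matrix `a` are homomorphisms. -/
def RowsHom (F : KGraph k W) (H : KGraph k V) (a : W × W → V) : Prop :=
  ∀ w, F.IsHom H fun u => a (w, u)

/-- One can select an entry of every row of `a` so that the selected entries form a homomorphism,
and the rows remain homomorphisms after the selected entries are exchanged for those of `R`. -/
def Absorbs (F : KGraph k W) (H : KGraph k V) (a : W × W → V) (R : W → V) : Prop :=
  ∃ ρ : W → W, F.IsHom H (fun w => a (w, ρ w)) ∧
    ∀ w, F.IsHom H (Function.update (fun u => a (w, u)) (ρ w) (R w))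

/-- Swapping v with the value S ρ is an involution on pairs (v, S). -/
theorem sum_card_isHom_update_le [Fintype V] [Fintype W] (F : KGraph k W) (H : KGraph k V)
    (ρ : W) : ∑ v, #{S : W → V | F.IsHom H (Function.update S ρ v)}
      ≤ Fintype.card V * #{S | F.IsHom H S} := by
  rw [← card_sigma, ← card_univ, ← card_product]
  refine card_le_card_of_injOn (fun x => (x.2 ρ, Function.update x.2 ρ x.1)) ?_ ?_
  · rintro ⟨v, S⟩ h
    simpa using h
  · refine Set.injOn_of_injective
      (Function.LeftInverse.injective (g := fun x => ⟨x.2 ρ, Function.update x.2 ρ x.1⟩) ?_)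
    rintro ⟨v, S⟩
    simp

/-- The root may depend on v, so sum over all roots, at the cost of the factor |W|. -/
theorem card_isHom_ge [Fintype V] [Nonempty V] [Fintype W] (F : KGraph k W) (H : KGraph k V)
    {c : ℝ}
    (h : ∀ v, ∃ ρ, c * Fintype.card V ^ Fintype.card W
      ≤ #{S : W → V | F.IsHom H (Function.update S ρ v)}) :
    c / Fintype.card W * Fintype.card V ^ Fintype.card W ≤ #{S | F.IsHom H S} := by
  have hn : (0 : ℝ) < Fintype.card V := by exact_mod_cast Fintype.card_pos
  have hW : (0 : ℝ) < Fintype.card W := by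
    obtain ⟨ρ, -⟩ := h (Classical.arbitrary V)
    exact_mod_cast Fintype.card_pos_iff.2 ⟨ρ⟩
  choose ρ hρ using h
  have h1 : ∑ v : V, (#{S : W → V | F.IsHom H (Function.update S (ρ v) v)} : ℝ)
      ≤ Fintype.card W * (Fintype.card V * #{S | F.IsHom H S}) := by
    calc _ ≤ ∑ v : V, ∑ r : W, (#{S : W → V | F.IsHom H (Function.update S r v)} : ℝ) := by
          refine sum_le_sum fun v _ => ?_
          exact single_le_sum
            (f := fun r => (#{S : W → V | F.IsHom H (Function.update S r v)} : ℝ))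
            (fun _ _ => by positivity) (mem_univ (ρ v))
      _ = ∑ r : W, ∑ v : V, (#{S : W → V | F.IsHom H (Function.update S r v)} : ℝ) := sum_comm
      _ ≤ ∑ r : W, (Fintype.card V * #{S | F.IsHom H S} : ℝ) :=
          sum_le_sum fun r _ => by exact_mod_cast sum_card_isHom_update_le F H r
      _ = _ := by rw [sum_const, card_univ, nsmul_eq_mul]
  have h2 : Fintype.card V * (c * (Fintype.card V : ℝ) ^ Fintype.card W)
      ≤ ∑ v : V, (#{S : W → V | F.IsHom H (Function.update S (ρ v) v)} : ℝ) := by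
    rw [← nsmul_eq_mul, ← card_univ]
    exact card_nsmul_le_sum _ _ _ fun v _ => hρ v
  rw [div_mul_eq_mul_div, div_le_iff₀ hW]
  refine le_of_mul_le_mul_left ?_ hn
  linarith

/-- The absorbing matrices are obtained from a homomorphism `z` and, for each vertex `w` of `F`,
a map that can be completed both by `z w` and by `R w`. -/
theorem card_absorbs_ge [Fintype V] [Nonempty V] [Fintype W] [Nonempty W] (F : KGraph k W)
    (H : KGraph k V)
    (R : W → V) {b c : ℝ} (hc : 0 ≤ c) (Z : Finset (W → V)) (hZ : ∀ z ∈ Z, F.IsHom H z)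
    (hZc : b * Fintype.card V ^ Fintype.card W ≤ #Z)
    (h : ∀ z ∈ Z, ∀ w, ∃ ρ, c * Fintype.card V ^ Fintype.card W ≤ #{S : W → V |
      F.IsHom H (Function.update S ρ (z w)) ∧ F.IsHom H (Function.update S ρ (R w))}) :
    b * c ^ Fintype.card W / Fintype.card W ^ Fintype.card W * Fintype.card V ^ Fintype.card (W × W)
      ≤ #{a | F.RowsHom H a ∧ F.Absorbs H a R} := by
  set n := (Fintype.card V : ℝ) with hn'
  set f := Fintype.card W with hf'
  have hn : (0 : ℝ) < n := by rw [hn']; exact_mod_cast Fintype.card_pos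
  have hf : (0 : ℝ) < f := by exact_mod_cast Fintype.card_pos
  -- Outside Z the root function is the dummy `id`, so that ρ can be chosen for all z at once.
  have h' : ∀ z : W → V, ∃ ρ : W → W, z ∈ Z → ∀ w, c * n ^ f ≤ #{S : W → V |
      F.IsHom H (Function.update S (ρ w) (z w)) ∧ F.IsHom H (Function.update S (ρ w) (R w))} := by
    intro z
    by_cases hz : z ∈ Z
    · choose ρ hρ using h z hz
      exact ⟨ρ, fun _ => hρ⟩
    · exact ⟨id, fun hz' => absurd hz' hz⟩
  choose ρ hρ using h'
  set T : (W → V) → Finset (W → W → V) := fun z => Fintype.piFinset fun w => {S : W → V |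
      F.IsHom H (Function.update S (ρ z w) (z w)) ∧
      F.IsHom H (Function.update S (ρ z w) (R w))} with hT
  have hTc : ∀ z ∈ Z, (c * n ^ f) ^ f ≤ (#(T z) : ℝ) := by
    intro z hz
    rw [hT, Fintype.card_piFinset, Nat.cast_prod, hf', ← card_univ, ← prod_const]
    exact prod_le_prod (fun _ _ => by positivity) fun w _ => hρ z hz w
  set G : Finset (W × W → V) := {a | F.RowsHom H a ∧ F.Absorbs H a R} with hG
  -- The matrix forgets only the overwritten values S w (ρ w) and the choice of ρ; recording them
  -- makes the map injective, at a price of n ^ f * f ^ f.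
  have hinj : #(Z.sigma T) ≤ #(G ×ˢ ((univ : Finset (W → V)) ×ˢ (univ : Finset (W → W)))) := by
    refine card_le_card_of_injOn (fun x => (fun y => Function.update (x.2 y.1) (ρ x.1 y.1) (x.1 y.1)
      y.2, fun w => x.2 w (ρ x.1 w), ρ x.1)) ?_ ?_
    · rintro ⟨z, S⟩ hx
      simp only [coe_sigma, Set.mem_sigma_iff, mem_coe, hT, Fintype.mem_piFinset, mem_filter,
        mem_univ, true_and] at hx
      simp only [coe_product, Set.mem_prod, mem_coe, mem_univ, and_true, hG, mem_filter,
        true_and]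
      refine ⟨fun w => (hx.2 w).1, ρ z, ?_, fun w => ?_⟩
      · simpa using hZ z hx.1
      · have h1 := (hx.2 w).2
        have h2 : Function.update (fun u => Function.update (S w) (ρ z w) (z w) u) (ρ z w) (R w)
            = Function.update (S w) (ρ z w) (R w) := Function.update_idem _ _ _
        rw [h2]
        exact h1
    · refine Set.injOn_of_injective (Function.LeftInverse.injective
        (g := fun y => ⟨fun w => y.1 (w, y.2.2 w), fun w =>
          Function.update (fun u => y.1 (w, u)) (y.2.2 w) (y.2.1 w)⟩) ?_)
      rintro ⟨z, S⟩
      simp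
  have h1 : #Z * (c * n ^ f) ^ f ≤ (#(Z.sigma T) : ℝ) := by
    rw [card_sigma, Nat.cast_sum, ← nsmul_eq_mul]
    exact card_nsmul_le_sum _ _ _ hTc
  have h2 : (#(Z.sigma T) : ℝ) ≤ #G * (n ^ f * f ^ f) := by
    have : (#(G ×ˢ ((univ : Finset (W → V)) ×ˢ (univ : Finset (W → W)))) : ℝ)
        = #G * (n ^ f * f ^ f) := by
      rw [card_product, card_product, card_univ, card_univ, Fintype.card_fun, Fintype.card_fun]
      push_cast
      rfl
    rw [← this]
    exact_mod_cast hinj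
  have h3 : b * n ^ f * (c * n ^ f) ^ f ≤ #G * (n ^ f * f ^ f) :=
    (mul_le_mul_of_nonneg_right hZc (by positivity)).trans (h1.trans h2)
  rw [Fintype.card_prod, div_mul_eq_mul_div, div_le_iff₀ (by positivity)]
  refine le_of_mul_le_mul_right ?_ (pow_pos hn f)
  calc _ = b * n ^ f * (c * n ^ f) ^ f := by rw [mul_pow, ← pow_mul]; ring
    _ ≤ _ := h3
    _ = _ := by ring

/-- Two vertices are linked by many maps completable by either one as soon as their common link is
dense. Density against the link of r fails to give this for only a few x, so most homomorphisms z
pair well with R in every coordinate. -/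
theorem exists_card_absorbs_ge [Fintype W] [Nonempty W] (hk : 1 ≤ k) {F : KGraph k W}
    (hF : F ∈ edgeCOVER k 1 W) {p α : ℝ} (hp : 0 < p) (hp1 : p < 1) (hα : 0 < α) :
    ∃ μ c : ℝ, 0 < μ ∧ 0 < c ∧ ∀ (V : Type) [Fintype V] (H : KGraph k V),
      RelDense H.Hit p μ →
      (∀ v, α * (Fintype.card V : ℝ) ^ (k - 1) ≤ H.tupleDegree v) → ∀ R : W → V,
      c * Fintype.card V ^ Fintype.card (W × W) ≤ #{a | F.RowsHom H a ∧ F.Absorbs H a R} := by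
  obtain ⟨μ₁, c₁, hμ₁, hc₁, h⟩ := exists_card_isRootedHom_ge hk hF hp hp1
    (α := p / 2 * α) (by positivity)
  set f := (Fintype.card W : ℝ) with hf'
  have hf : 0 < f := by rw [hf']; exact_mod_cast Fintype.card_pos
  -- With this ε, maps z having some z w in the bad set of R w number at most f ε n ^ f, half of the
  -- guaranteed homomorphisms.
  set ε := c₁ / (2 * f ^ 2) with hε
  have hε0 : 0 < ε := by positivity
  refine ⟨min μ₁ (p / 2 * ε * α), c₁ / (2 * f) * c₁ ^ Fintype.card W / f ^ Fintype.card W,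
    by positivity, by positivity, ?_⟩
  intro V _ H hd hdeg R
  have : Nonempty V := ⟨R (Classical.arbitrary W)⟩
  set n := (Fintype.card V : ℝ) with hn'
  have hn : (0 : ℝ) < n := by rw [hn']; exact_mod_cast Fintype.card_pos
  have hd₁ := hd.mono (min_le_left _ _)
  have hhom : c₁ / f * n ^ Fintype.card W ≤ #{S : W → V | F.IsHom H S} := by
    refine card_isHom_ge F H fun v => ?_
    obtain ⟨ρ, hρ⟩ := h V H (fun s => insert v s ∈ H.edges) hd₁ (by
      have h1 : p / 2 * α * n ^ (k - 1) ≤ α * n ^ (k - 1) := by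
        gcongr
        exact mul_le_of_le_one_left hα.le (by linarith)
      exact (h1.trans (hdeg v)).trans (le_of_eq (by unfold tupleDegree Hit; congr!)))
    refine ⟨ρ, hρ.trans (Nat.cast_le.2 (card_le_card fun S hS => ?_))⟩
    rw [mem_filter] at hS ⊢
    exact ⟨hS.1, hS.2.isHom_update fun s hs => hs⟩
  set bad : V → Finset V := fun r =>
    {x | (#{y ∈ ({y | H.Hit r y} : Finset (Fin (k - 1) → V)) | H.Hit x y} : ℝ)
      < p / 2 * #({y | H.Hit r y} : Finset (Fin (k - 1) → V))} with hbad
  have hbadc : ∀ r, (#(bad r) : ℝ) ≤ ε * n := by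
    intro r
    have h1 := (hd.mono (min_le_right _ _)).card_bad {y | H.Hit r y}
    rw [Fintype.card_fun, Fintype.card_fin, Nat.cast_pow, ← hn'] at h1
    have h2 : α * n ^ (k - 1) ≤ #({y | H.Hit r y} : Finset (Fin (k - 1) → V)) := hdeg r
    have h3 : p / 2 * #(bad r) * (α * n ^ (k - 1)) ≤ p / 2 * ε * α * (n * n ^ (k - 1)) :=
      (mul_le_mul_of_nonneg_left h2 (by positivity)).trans h1
    have h4 : 0 < p / 2 * (α * n ^ (k - 1)) := by positivity
    refine le_of_mul_le_mul_left ?_ h4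
    linarith
  have hreach : ∀ r, ∀ x ∉ bad r, ∃ ρ, c₁ * n ^ Fintype.card W ≤ #{S : W → V |
      F.IsHom H (Function.update S ρ x) ∧ F.IsHom H (Function.update S ρ r)} := by
    intro r x hx
    obtain ⟨ρ, hρ⟩ := h V H (fun s => insert r s ∈ H.edges ∧ insert x s ∈ H.edges) hd₁ (by
      rw [hbad, mem_filter, not_and, not_lt] at hx
      have h1 := hx (mem_univ _)
      have h2 : α * n ^ (k - 1) ≤ #({y | H.Hit r y} : Finset (Fin (k - 1) → V)) := hdeg r
      rw [filter_filter] at h1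
      calc p / 2 * α * n ^ (k - 1) = p / 2 * (α * n ^ (k - 1)) := by ring
        _ ≤ p / 2 * #({y | H.Hit r y} : Finset (Fin (k - 1) → V)) := by gcongr
        _ ≤ _ := h1
        _ = _ := by unfold Hit; congr!)
    refine ⟨ρ, hρ.trans (Nat.cast_le.2 (card_le_card fun S hS => ?_))⟩
    rw [mem_filter] at hS ⊢
    exact ⟨hS.1, hS.2.isHom_update fun s hs => hs.2, hS.2.isHom_update fun s hs => hs.1⟩
  set Z : Finset (W → V) := {z | F.IsHom H z ∧ ∀ w, z w ∉ bad (R w)} with hZ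
  refine card_absorbs_ge F H R hc₁.le Z (fun z hz => (mem_filter.1 hz).2.1) ?_
    fun z hz w => hreach _ _ ((mem_filter.1 hz).2.2 w)
  have h1 := card_exists_mem_le (J := W) (fun w => bad (R w)) (fun w => hbadc (R w))
  have h2 : (#{g : W → V | ∃ j, g j ∈ bad (R j)} : ℝ) ≤ f * ε * n ^ Fintype.card W := by
    refine le_of_mul_le_mul_right (h1.trans (le_of_eq ?_)) hn
    ring
  have h3 : #{S : W → V | F.IsHom H S} ≤ #Z + #{g : W → V | ∃ j, g j ∈ bad (R j)} := by
    refine (card_le_card fun z hz => ?_).trans (card_union_le _ _)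
    rw [mem_union, hZ, mem_filter, mem_filter]
    by_cases hb : ∃ j, z j ∈ bad (R j)
    · exact Or.inr ⟨mem_univ _, hb⟩
    · exact Or.inl ⟨mem_univ _, (mem_filter.1 hz).2, not_exists.1 hb⟩
  have h3' : (#{S : W → V | F.IsHom H S} : ℝ) ≤ #Z + #{g : W → V | ∃ j, g j ∈ bad (R j)} := by
    exact_mod_cast h3
  have h4 : f * ε = c₁ / (2 * f) := by rw [hε]; field_simp
  have h5 : c₁ / f = c₁ / (2 * f) + c₁ / (2 * f) := by field_simp; norm_num
  rw [h4] at h2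
  rw [h5] at hhom
  linarith

end KGraph

/-! ### Random selection of a disjoint family. -/

section RandomSelection

open Finset
open scoped Classical

/-- Exponential moment bound for the number of samples that land in a set of density `c`. -/
theorem card_few_hits_le {A : Type*} [Fintype A] (G : Finset A) {c : ℝ} (hc1 : c ≤ 1)
    (hG : c * Fintype.card A ≤ #G) (T s : ℕ) (hs : s ≤ c * T / 4) :
    (#{ω : Fin T → A | #{t | ω t ∈ G} ≤ s} : ℝ)
      ≤ Real.exp (-(c * T / 4)) * Fintype.card A ^ T := by
  set N := (Fintype.card A : ℝ)
  -- Each hit gets weight 1/2. The mean weight of a sample is at most (1 - c/2) ^ T ≤ exp(-cT/2),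
  -- whereas at most s hits force weight at least 2 ^ (-s) ≥ exp(-cT/4).
  have hsum : ∑ a : A, (if a ∈ G then (1 / 2 : ℝ) else 1) ≤ N * (1 - c / 2) := by
    have h1 : ∀ a : A, (if a ∈ G then (1 / 2 : ℝ) else 1) = 1 - (if a ∈ G then 1 / 2 else 0) := by
      intro a; split_ifs <;> norm_num
    simp only [h1, sum_sub_distrib, sum_ite_mem, univ_inter, sum_const, card_univ, nsmul_eq_mul]
    linarith
  have hprod : ∀ ω : Fin T → A, ∏ t, (if ω t ∈ G then (1 / 2 : ℝ) else 1)
      = (1 / 2) ^ #{t | ω t ∈ G} := by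
    intro ω
    rw [prod_ite, prod_const, prod_const_one, mul_one]
  have h1 : (1 / 2 : ℝ) ^ s * #{ω : Fin T → A | #{t | ω t ∈ G} ≤ s} ≤ (N * (1 - c / 2)) ^ T := by
    calc _ = ∑ ω : Fin T → A with #{t | ω t ∈ G} ≤ s, (1 / 2 : ℝ) ^ s := by
          rw [sum_const, nsmul_eq_mul, mul_comm]
      _ ≤ ∑ ω : Fin T → A with #{t | ω t ∈ G} ≤ s, (1 / 2 : ℝ) ^ #{t | ω t ∈ G} :=
          sum_le_sum fun ω hω => pow_le_pow_of_le_one (by norm_num) (by norm_num)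
            (mem_filter.1 hω).2
      _ ≤ ∑ ω : Fin T → A, (1 / 2 : ℝ) ^ #{t | ω t ∈ G} :=
          sum_le_sum_of_subset_of_nonneg (filter_subset _ _) fun _ _ _ => by positivity
      _ = (∑ a : A, (if a ∈ G then (1 / 2 : ℝ) else 1)) ^ T := by
          rw [Fintype.sum_pow]
          exact sum_congr rfl fun ω _ => (hprod ω).symm
      _ ≤ _ := by
          refine pow_le_pow_left₀ (sum_nonneg fun a _ => ?_) hsum _
          split_ifs <;> norm_num
  have h2 : (#{ω : Fin T → A | #{t | ω t ∈ G} ≤ s} : ℝ) ≤ 2 ^ s * (N * (1 - c / 2)) ^ T := by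
    rw [div_pow, one_pow, one_div, inv_mul_le_iff₀ (by positivity)] at h1
    exact h1
  refine h2.trans ?_
  have h3 : (2 : ℝ) ^ s ≤ Real.exp (c * T / 4) := by
    calc (2 : ℝ) ^ s ≤ (Real.exp 1) ^ s := by
          gcongr
          have := Real.add_one_le_exp 1
          linarith
      _ = Real.exp s := by rw [← Real.exp_nat_mul, mul_one]
      _ ≤ _ := Real.exp_le_exp.2 hs
  have h4 : (1 - c / 2) ^ T ≤ Real.exp (-(c * T / 2)) := by
    calc (1 - c / 2) ^ T ≤ (Real.exp (-(c / 2))) ^ T := by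
          refine pow_le_pow_left₀ (by linarith) ?_ _
          have := Real.add_one_le_exp (-(c / 2))
          linarith
      _ = _ := by rw [← Real.exp_nat_mul]; congr 1; ring
  calc _ = (2 : ℝ) ^ s * (1 - c / 2) ^ T * N ^ T := by rw [mul_pow]; ring
    _ ≤ Real.exp (c * T / 4) * Real.exp (-(c * T / 2)) * N ^ T := by
        have : 0 ≤ (1 - c / 2) ^ T := pow_nonneg (by linarith) _
        gcongr
    _ = _ := by rw [← Real.exp_add]; congr 2; ring

theorem card_exists_few_hits_le {A Q : Type*} [Fintype A] [Fintype Q] (G : Q → Finset A) {c : ℝ}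
    (hc1 : c ≤ 1) (hG : ∀ R, c * Fintype.card A ≤ #(G R)) (T s : ℕ) (hs : s ≤ c * T / 4) :
    (#{ω : Fin T → A | ∃ R, #{t | ω t ∈ G R} ≤ s} : ℝ)
      ≤ Fintype.card Q * (Real.exp (-(c * T / 4)) * Fintype.card A ^ T) := by
  have h1 : #{ω : Fin T → A | ∃ R, #{t | ω t ∈ G R} ≤ s}
      ≤ ∑ R, #{ω : Fin T → A | #{t | ω t ∈ G R} ≤ s} := by
    refine (card_le_card fun ω hω => ?_).trans card_biUnion_le
    obtain ⟨R, hR⟩ := (mem_filter.1 hω).2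
    exact mem_biUnion.2 ⟨R, mem_univ _, mem_filter.2 ⟨mem_univ _, hR⟩⟩
  calc _ ≤ ∑ R, (#{ω : Fin T → A | #{t | ω t ∈ G R} ≤ s} : ℝ) := by exact_mod_cast h1
    _ ≤ ∑ _R : Q, Real.exp (-(c * T / 4)) * (Fintype.card A : ℝ) ^ T :=
        sum_le_sum fun R _ => card_few_hits_le (G R) hc1 (hG R) T s hs
    _ = _ := by rw [sum_const, card_univ, nsmul_eq_mul]

/-- The entries of `g` at two distinct positions agree. -/
def Collides {I V : Type*} (g : I → V) (x : I × I) : Prop := x.1 ≠ x.2 ∧ g x.1 = g x.2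

/-- The pairs of distinct positions carrying equal entries. -/
noncomputable def collisions {I V : Type*} [Fintype I] (g : I → V) : Finset (I × I) :=
  {x | Collides g x}

theorem sum_card_collisions_le {I V : Type*} [Fintype I] [DecidableEq I] [Fintype V] :
    (∑ g : I → V, #(collisions g)) * Fintype.card V
      ≤ Fintype.card I ^ 2 * Fintype.card V ^ Fintype.card I := by
  have h1 : ∑ g : I → V, #(collisions g)
      = ∑ x : I × I, #{g : I → V | Collides g x} :=
    sum_card_bipartiteAbove_eq_sum_card_bipartiteBelow
      (s := (univ : Finset (I → V))) (t := (univ : Finset (I × I)))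
      Collides
  have h2 : ∀ x : I × I, #{g : I → V | Collides g x} * Fintype.card V
      ≤ Fintype.card V ^ Fintype.card I := by
    rintro ⟨i, j⟩
    by_cases hij : i = j
    · simp [Collides, hij]
    · have h3 := card_apply_eq_apply_le (V := V) hij
      refine (Nat.mul_le_mul_right _ (card_le_card fun g hg => ?_)).trans h3
      exact mem_filter.2 ⟨mem_univ _, (mem_filter.1 hg).2.2⟩
  rw [h1, sum_mul]
  refine (sum_le_card_nsmul _ _ _ fun x _ => h2 x).trans ?_
  rw [card_univ, Fintype.card_prod, smul_eq_mul, sq]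

/-- Markov's inequality: the threshold is twice the bound on the expected number of collisions. -/
theorem card_many_collisions_le {J V : Type*} [Fintype J] [Nonempty J] [Fintype V] [Nonempty V]
    {T : ℕ} (hT : 0 < T) :
    (#{ω : Fin T → J → V | 2 * ((T : ℝ) * Fintype.card J) ^ 2 / Fintype.card V
      ≤ #(collisions (Function.uncurry ω))} : ℝ) ≤ Fintype.card (J → V) ^ T / 2 := by
  have hn : (0 : ℝ) < Fintype.card V := by exact_mod_cast Fintype.card_pos
  have hd : (0 : ℝ) < Fintype.card J := by exact_mod_cast Fintype.card_pos
  have hT' : (0 : ℝ) < T := by exact_mod_cast hT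
  set B : Finset (Fin T → J → V) := {ω | 2 * ((T : ℝ) * Fintype.card J) ^ 2 / Fintype.card V
      ≤ #(collisions (Function.uncurry ω))}
  have h1 : ∑ ω : Fin T → J → V, #(collisions (Function.uncurry ω))
      = ∑ g : Fin T × J → V, #(collisions g) :=
    (Equiv.curry (Fin T) J V).symm.sum_comp fun g => #(collisions g)
  have h2 : (∑ ω : Fin T → J → V, (#(collisions (Function.uncurry ω)) : ℝ)) * Fintype.card V
      ≤ ((T : ℝ) * Fintype.card J) ^ 2 * Fintype.card (J → V) ^ T := by
    have h3 := sum_card_collisions_le (I := Fin T × J) (V := V)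
    rw [← h1, Fintype.card_prod, Fintype.card_fin, mul_comm T (Fintype.card J), pow_mul] at h3
    rw [Fintype.card_fun, mul_comm (T : ℝ)]
    exact_mod_cast h3
  have h3 : #B * (2 * ((T : ℝ) * Fintype.card J) ^ 2 / Fintype.card V)
      ≤ ∑ ω : Fin T → J → V, (#(collisions (Function.uncurry ω)) : ℝ) := by
    rw [← nsmul_eq_mul]
    exact (card_nsmul_le_sum B (fun ω => (#(collisions (Function.uncurry ω)) : ℝ)) _
      fun ω hω => (mem_filter.1 hω).2).trans
      (sum_le_sum_of_subset_of_nonneg (subset_univ _) fun _ _ _ => by positivity)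
  rw [mul_div_assoc', div_le_iff₀ hn] at h3
  have h5 : 0 < ((T : ℝ) * Fintype.card J) ^ 2 := by positivity
  refine le_of_mul_le_mul_left ?_ h5
  linarith

theorem exists_forall_pow_mul_exp_lt (f : ℕ) {b : ℝ} (hb : 0 < b) :
    ∃ n₀ : ℕ, ∀ n : ℕ, n₀ ≤ n → (n : ℝ) ^ f * Real.exp (-(b * n)) < 1 / 2 := by
  have h1 := (Real.tendsto_pow_mul_exp_neg_atTop_nhds_zero f).comp
    (tendsto_natCast_atTop_atTop.const_mul_atTop hb)
  have h2 := h1.eventually (gt_mem_nhds (show (0 : ℝ) < b ^ f / 2 by positivity))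
  obtain ⟨n₀, hn₀⟩ := Filter.eventually_atTop.1 h2
  refine ⟨n₀, fun n hn => ?_⟩
  have h3 := hn₀ n hn
  simp only [Function.comp_apply, mul_pow] at h3
  have h4 : 0 < b ^ f := by positivity
  refine lt_of_mul_lt_mul_left ?_ h4.le
  linarith

/-- If every request is served by a positive proportion of all tuples, then there is a family of
pairwise disjoint tuples in which every request is served linearly often. -/
theorem exists_disjoint_family {J ι : Type*} [Fintype J] [Nonempty J] [Fintype ι] {c : ℝ}
    (hc : 0 < c) (hc1 : c ≤ 1) :
    ∃ (n₀ : ℕ) (ξ : ℝ), 0 < ξ ∧ ∀ (V : Type) [Fintype V], n₀ ≤ Fintype.card V →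
      ∀ G : (ι → V) → Finset (J → V),
      (∀ R, c * Fintype.card V ^ Fintype.card J ≤ #(G R)) →
      ∃ (T : ℕ) (ω : Fin T → J → V) (I : Finset (Fin T)),
        (∀ t ∈ I, Function.Injective (ω t)) ∧
        (∀ t ∈ I, ∀ t' ∈ I, t ≠ t' → ∀ j j', ω t j ≠ ω t' j') ∧
        ∀ R, ξ * Fintype.card V ≤ #{t ∈ I | ω t ∈ G R} := by
  set d := (Fintype.card J : ℝ) with hd
  have hd0 : 0 < d := by rw [hd]; exact_mod_cast Fintype.card_pos
  -- About τ n samples are drawn. Every request then has more than cT/4 - 1 hits, with room for a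
  -- union bound over n ^ |ι| requests, while collisions number fewer than 2(Td)²/n ≤ cT/8.
  set τ := c / (16 * d ^ 2) with hτ
  have hτ0 : 0 < τ := by positivity
  obtain ⟨n₁, hn₁⟩ := exists_forall_pow_mul_exp_lt (Fintype.card ι) (b := c * τ / 8) (by positivity)
  refine ⟨n₁ + ⌈2 / τ⌉₊ + 1, c * τ / 16, by positivity, ?_⟩
  intro V _ hn G hG
  set n := (Fintype.card V : ℝ) with hn'
  have hn0 : 0 < n := by rw [hn']; exact_mod_cast (by omega : 0 < Fintype.card V)
  have hτn : 2 ≤ τ * n := by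
    have : 2 / τ ≤ n := (Nat.le_ceil _).trans (Nat.cast_le.2 (by omega))
    rw [div_le_iff₀ hτ0] at this
    linarith
  obtain ⟨T, hT⟩ : ∃ T, T = ⌊τ * n⌋₊ := ⟨_, rfl⟩
  have hT1 : (T : ℝ) ≤ τ * n := hT ▸ Nat.floor_le (by positivity)
  have hT2 : τ * n / 2 ≤ T := by
    have := Nat.lt_floor_add_one (τ * n)
    rw [← hT] at this
    linarith
  have hT0 : (0 : ℝ) < T := by linarith
  obtain ⟨s, hs⟩ : ∃ s, s = ⌊c * T / 4⌋₊ := ⟨_, rfl⟩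
  have hs1 : (s : ℝ) ≤ c * T / 4 := hs ▸ Nat.floor_le (by positivity)
  have hs2 : c * T / 4 < s + 1 := hs ▸ Nat.lt_floor_add_one _
  set bad₁ : Finset (Fin T → J → V) := {ω | ∃ R, #{t | ω t ∈ G R} ≤ s} with hbad₁
  set M := (Fintype.card (J → V) : ℝ) ^ T with hM
  have : Nonempty V := Fintype.card_pos_iff.1 (by omega)
  have hM0 : 0 < M := by rw [hM, Fintype.card_fun]; positivity
  have hb₁ : (#bad₁ : ℝ) < M / 2 := by
    have h0 := card_exists_few_hits_le G hc1
      (by intro R; rw [Fintype.card_fun, Nat.cast_pow]; exact hG R) T s hs1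
    rw [← hM, Fintype.card_fun, Nat.cast_pow, ← hn'] at h0
    have h1 : (#bad₁ : ℝ) ≤ n ^ Fintype.card ι * (Real.exp (-(c * T / 4)) * M) := by
      refine le_of_eq_of_le ?_ h0
      rw [hbad₁]
      congr!
    have h3 : Real.exp (-(c * T / 4)) ≤ Real.exp (-(c * τ / 8 * n)) := by
      refine Real.exp_le_exp.2 (neg_le_neg ?_)
      have := mul_le_mul_of_nonneg_left hT2 hc.le
      linarith
    have h4 := hn₁ (Fintype.card V) (by omega)
    calc (#bad₁ : ℝ) ≤ n ^ Fintype.card ι * (Real.exp (-(c * T / 4)) * M) := h1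
      _ ≤ n ^ Fintype.card ι * (Real.exp (-(c * τ / 8 * n)) * M) := by gcongr
      _ = n ^ Fintype.card ι * Real.exp (-(c * τ / 8 * n)) * M := by ring
      _ < 1 / 2 * M := mul_lt_mul_of_pos_right h4 hM0
      _ = M / 2 := by ring
  set K := 2 * (T * d) ^ 2 / n with hK
  set bad₂ : Finset (Fin T → J → V) := {ω | K ≤ #(collisions (Function.uncurry ω))} with hbad₂
  have hb₂ : (#bad₂ : ℝ) ≤ M / 2 := card_many_collisions_le (by exact_mod_cast hT0)
  obtain ⟨ω, hω⟩ : ∃ ω, ω ∉ bad₁ ∪ bad₂ := by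
    by_contra! hall
    have h2 : Fintype.card (Fin T → J → V) ≤ #bad₁ + #bad₂ := by
      rw [← card_univ]
      exact (card_le_card fun ω _ => hall ω).trans (card_union_le _ _)
    rw [Fintype.card_fun, Fintype.card_fin] at h2
    have h3 : M ≤ #bad₁ + #bad₂ := by rw [hM]; exact_mod_cast h2
    linarith
  rw [mem_union, not_or] at hω
  have hmany : ∀ R, s < #{t | ω t ∈ G R} := by
    intro R
    by_contra! hle
    exact hω.1 (mem_filter.2 ⟨mem_univ _, R, hle⟩)
  have hfew : (#(collisions (Function.uncurry ω)) : ℝ) < K := by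
    by_contra! hle
    exact hω.2 (mem_filter.2 ⟨mem_univ _, hle⟩)
  -- Keeping only tuples whose entries occur nowhere else yields injectivity and disjointness
  -- together; each discarded tuple is charged to a collision.
  set I : Finset (Fin T) := {t | ∀ j, ∀ x : Fin T × J, (t, j) ≠ x → ω t j ≠ ω x.1 x.2} with hI
  have hIc : #Iᶜ ≤ #(collisions (Function.uncurry ω)) := by
    have h1 : Iᶜ ⊆ (collisions (Function.uncurry ω)).image fun x => x.1.1 := by
      intro t ht
      rw [mem_compl, hI, mem_filter] at ht
      simp only [mem_univ, true_and, not_forall, not_not] at ht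
      obtain ⟨j, x, hne, heq⟩ := ht
      exact mem_image.2 ⟨((t, j), x), mem_filter.2 ⟨mem_univ _, hne, heq⟩, rfl⟩
    exact (card_le_card h1).trans card_image_le
  refine ⟨T, ω, I, fun t ht => ?_, fun t ht t' _ hne j j' => ?_, fun R => ?_⟩
  · intro j j' hjj
    by_contra hne
    exact (mem_filter.1 ht).2 j (t, j') (by simpa using hne) hjj
  · exact (mem_filter.1 ht).2 j (t', j') (by simp [hne])
  · have h1 : #{t | ω t ∈ G R} ≤ #{t ∈ I | ω t ∈ G R} + #Iᶜ := by
      refine (card_le_card fun t ht => ?_).trans (card_union_le _ _)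
      rw [mem_union, mem_filter, mem_compl]
      by_cases h : t ∈ I
      · exact Or.inl ⟨h, (mem_filter.1 ht).2⟩
      · exact Or.inr h
    have h2 : (s : ℝ) + 1 ≤ #{t ∈ I | ω t ∈ G R} + #(collisions (Function.uncurry ω)) := by
      exact_mod_cast (hmany R).trans_le (h1.trans (Nat.add_le_add_left hIc _))
    have h3 : K ≤ c * T / 8 := by
      rw [hK, div_le_iff₀ hn0]
      have e1 : 2 * (T * d) ^ 2 = 2 * d ^ 2 * T * T := by ring
      have e2 : 2 * d ^ 2 * T * T ≤ 2 * d ^ 2 * T * (τ * n) := by gcongr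
      have e3 : 2 * d ^ 2 * T * (τ * n) = c * T / 8 * n := by
        rw [hτ]; field_simp; norm_num
      linarith
    have h4 := mul_le_mul_of_nonneg_left hT2 hc.le
    linarith

end RandomSelection

/-! ### Tilings, absorption of the leftover, and COVER ⊆ FACTOR. -/

namespace KGraph

open Finset
open scoped Classical

variable {k : ℕ} {V W : Type*}

/-- `U` is a disjoint union of vertex sets of copies of `F` in `H`. -/
inductive Tiled [Fintype W] (F : KGraph k W) (H : KGraph k V) : Finset V → Prop
  | empty : Tiled F H ∅
  | cons (g : W → V) (hg : F.IsHom H g) (hi : Function.Injective g) (U : Finset V)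
      (hU : Tiled F H U) (hd : ∀ w, g w ∉ U) : Tiled F H (univ.image g ∪ U)

namespace Tiled

variable [Fintype W] {F : KGraph k W} {H : KGraph k V}

theorem card_dvd {U : Finset V} (h : Tiled F H U) : Fintype.card W ∣ #U := by
  induction h with
  | empty => simp
  | cons g hg hi U hU hd ih =>
    rw [card_union_of_disjoint, card_image_of_injective _ hi, card_univ]
    · exact (dvd_refl _).add ih
    · exact disjoint_left.2 fun v hv => by
        obtain ⟨w, -, rfl⟩ := mem_image.1 hv
        exact hd w

theorem union {U U' : Finset V} (h : Tiled F H U) (h' : Tiled F H U') (hd : Disjoint U U') :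
    Tiled F H (U ∪ U') := by
  induction h with
  | empty => simpa using h'
  | cons g hg hi U hU hdU ih =>
    rw [disjoint_union_left] at hd
    rw [union_assoc]
    refine Tiled.cons g hg hi _ (ih hd.2) fun w hw => ?_
    rcases mem_union.1 hw with hw | hw
    · exact hdU w hw
    · exact disjoint_left.1 hd.1 (mem_image_of_mem g (mem_univ w)) hw

theorem biUnion {ι : Type*} (s : Finset ι) (U : ι → Finset V) (h : ∀ i ∈ s, Tiled F H (U i))
    (hd : ∀ i ∈ s, ∀ j ∈ s, i ≠ j → Disjoint (U i) (U j)) : Tiled F H (s.biUnion U) := by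
  induction s using Finset.induction_on with
  | empty => simpa using Tiled.empty
  | insert i s hi ih =>
    rw [biUnion_insert]
    refine (h i (mem_insert_self _ _)).union (ih (fun j hj => h j (mem_insert_of_mem hj))
      fun j hj l hl => hd j (mem_insert_of_mem hj) l (mem_insert_of_mem hl)) ?_
    rw [disjoint_biUnion_right]
    exact fun j hj => hd i (mem_insert_self _ _) j (mem_insert_of_mem hj) fun hij => hi (hij ▸ hj)

theorem image_isHom {g : W → V} (hg : F.IsHom H g) (hi : Function.Injective g) :
    Tiled F H (univ.image g) := by
  simpa using Tiled.cons g hg hi ∅ Tiled.empty (by simp)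

theorem image_matrix {ι : Type*} [Fintype ι] {b : ι × W → V} (hb : Function.Injective b)
    (hrow : ∀ i, F.IsHom H fun w => b (i, w)) : Tiled F H (univ.image b) := by
  have h1 : univ.image b = univ.biUnion fun i => univ.image fun w => b (i, w) := by
    ext v; simp
  rw [h1]
  refine Tiled.biUnion _ _ (fun i _ => image_isHom (hrow i) fun w w' h => ?_)
    fun i _ j _ hij => disjoint_left.2 fun v hv hv' => ?_
  · exact (Prod.mk.inj (hb h)).2
  · obtain ⟨w, -, rfl⟩ := mem_image.1 hv
    obtain ⟨w', -, h⟩ := mem_image.1 hv'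
    exact hij (Prod.mk.inj (hb h)).1.symm

theorem exists_copies {U : Finset V} (h : Tiled F H U) :
    ∃ T : Set (Copy F H), (∀ c ∈ T, ∀ c' ∈ T, c ≠ c' → Disjoint c.verts c'.verts) ∧
      (∀ c ∈ T, ∀ v ∈ c.verts, v ∈ U) ∧ ∀ v ∈ U, ∃ c ∈ T, v ∈ c.verts := by
  induction h with
  | empty => exact ⟨∅, by simp⟩
  | cons g hg hi U hU hd ih =>
    obtain ⟨T, h1, h2, h3⟩ := ih
    have hdisj : ∀ c ∈ T, Disjoint (hg.copy hi).verts c.verts := by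
      intro c hc
      refine Set.disjoint_left.2 ?_
      rintro _ ⟨w, rfl⟩ hv
      exact hd w (h2 c hc _ hv)
    refine ⟨insert (hg.copy hi) T, ?_, ?_, ?_⟩
    · rintro c (rfl | hc) c' (rfl | hc') hne
      · exact absurd rfl hne
      · exact hdisj c' hc'
      · exact (hdisj c hc).symm
      · exact h1 c hc c' hc' hne
    · rintro c (rfl | hc) v hv
      · obtain ⟨w, rfl⟩ := hv
        exact mem_union_left _ (mem_image_of_mem g (mem_univ w))
      · exact mem_union_right _ (h2 c hc v hv)
    · intro v hv
      rcases mem_union.1 hv with hv | hv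
      · obtain ⟨w, -, rfl⟩ := mem_image.1 hv
        exact ⟨_, Set.mem_insert _ _, w, rfl⟩
      · obtain ⟨c, hc, hvc⟩ := h3 v hv
        exact ⟨c, Set.mem_insert_of_mem _ hc, hvc⟩

theorem hasFactor [Fintype V] (h : Tiled F H univ) : HasFactor F H := by
  obtain ⟨T, h1, -, h3⟩ := h.exists_copies
  exact ⟨T, h1, fun v => h3 v (mem_univ v)⟩

end Tiled

variable [Fintype W] {F : KGraph k W} {H : KGraph k V}

/-- The selected entries form one copy, and each row with its selected entry replaced by R w forms
another; together these |W| + 1 copies use exactly the entries of a and R. -/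
theorem Absorbs.tiled {a : W × W → V} {R : W → V} (h : F.Absorbs H a R)
    (ha : Function.Injective a) (hR : Function.Injective R) (hd : ∀ x w, a x ≠ R w) :
    Tiled F H (univ.image a ∪ univ.image R) := by
  obtain ⟨ρ, h1, h2⟩ := h
  -- Row `none` is the copy of selected entries, row `some w` the exchanged row w.
  let b : Option W × W → V := fun x =>
    x.1.elim (a (x.2, ρ x.2)) fun w => Function.update (fun u => a (w, u)) (ρ w) (R w) x.2
  have hb0 : ∀ w, b (none, w) = a (w, ρ w) := fun _ => rfl
  have hb1 : ∀ w, b (some w, ρ w) = R w := fun w => by simp [b]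
  have hb2 : ∀ w u, u ≠ ρ w → b (some w, u) = a (w, u) := fun w u hu => by simp [b, hu]
  have key : ∀ w w' u, a (w, ρ w) ≠ b (some w', u) := by
    intro w w' u heq
    by_cases hu : u = ρ w'
    · rw [hu, hb1] at heq
      exact hd _ _ heq
    · rw [hb2 _ _ hu] at heq
      obtain ⟨rfl, rfl⟩ := Prod.mk.inj (ha heq)
      exact hu rfl
  have hbi : Function.Injective b := by
    rintro ⟨_ | w, u⟩ ⟨_ | w', u'⟩ heq
    · rw [hb0, hb0] at heq
      rw [(Prod.mk.inj (ha heq)).1]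
    · rw [hb0] at heq
      exact absurd heq (key _ _ _)
    · rw [hb0] at heq
      exact absurd heq.symm (key _ _ _)
    · by_cases hu : u = ρ w <;> by_cases hu' : u' = ρ w'
      · rw [hu, hu', hb1, hb1] at heq
        obtain rfl := hR heq
        rw [hu, hu']
      · rw [hu, hb1, hb2 _ _ hu'] at heq
        exact absurd heq.symm (hd _ _)
      · rw [hu', hb1, hb2 _ _ hu] at heq
        exact absurd heq (hd _ _)
      · rw [hb2 _ _ hu, hb2 _ _ hu'] at heq
        obtain ⟨rfl, rfl⟩ := Prod.mk.inj (ha heq)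
        rfl
  have himg : univ.image a ∪ univ.image R = univ.image b := by
    ext v
    simp only [mem_union, mem_image, mem_univ, true_and]
    constructor
    · rintro (⟨⟨w, u⟩, rfl⟩ | ⟨w, rfl⟩)
      · by_cases hu : u = ρ w
        · exact ⟨(none, w), by rw [hb0, hu]⟩
        · exact ⟨(some w, u), hb2 _ _ hu⟩
      · exact ⟨(some w, ρ w), hb1 w⟩
    · rintro ⟨⟨_ | w, u⟩, rfl⟩
      · exact Or.inl ⟨_, (hb0 u).symm⟩
      · by_cases hu : u = ρ w
        · exact Or.inr ⟨w, by rw [hu, hb1]⟩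
        · exact Or.inl ⟨_, (hb2 _ _ hu).symm⟩
  rw [himg]
  refine Tiled.image_matrix hbi ?_
  rintro (_ | w)
  · exact h1
  · exact h2 w

/-- A disjoint family of matrices that absorbs every map often enough absorbs every small set of
the right divisibility. -/
theorem tiled_absorbing_union {T : ℕ} {ω : Fin T → W × W → V} {I : Finset (Fin T)}
    (hrow : ∀ t ∈ I, F.RowsHom H (ω t)) (hinj : ∀ t ∈ I, Function.Injective (ω t))
    (hdisj : ∀ t ∈ I, ∀ t' ∈ I, t ≠ t' → ∀ j j', ω t j ≠ ω t' j') {s : ℕ}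
    (hmany : ∀ R : W → V, s ≤ #{t ∈ I | F.Absorbs H (ω t) R}) {Y : Finset V}
    (hY : #Y = s * Fintype.card W) (hYI : Disjoint (I.biUnion fun t => univ.image (ω t)) Y) :
    Tiled F H ((I.biUnion fun t => univ.image (ω t)) ∪ Y) := by
  have hcard : Fintype.card (Fin s × W) = Fintype.card Y := by
    rw [Fintype.card_prod, Fintype.card_fin, Fintype.card_coe, hY]
  let e : Fin s × W ≃ Y := Fintype.equivOfCardEq hcard
  let R : Fin s → W → V := fun i w => (e (i, w) : V)
  have hRinj : ∀ i i' w w', R i w = R i' w' → i = i' ∧ w = w' := fun i i' w w' h =>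
    Prod.mk.inj (e.injective (Subtype.val_injective h))
  have hRY : ∀ i w, R i w ∈ Y := fun i w => (e (i, w)).2
  -- Hall's condition is immediate: there are s requests and each alone has at least s absorbing
  -- matrices.
  obtain ⟨τ, hτi, hτ⟩ := (all_card_le_biUnion_card_iff_exists_injective
    (fun i : Fin s => ({t ∈ I | F.Absorbs H (ω t) (R i)} : Finset (Fin T)))).1 (by
      intro S
      rcases S.eq_empty_or_nonempty with rfl | ⟨i, hi⟩
      · simp
      · calc #S ≤ s := (card_le_univ S).trans_eq (Fintype.card_fin s)
          _ ≤ _ := hmany (R i)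
          _ ≤ _ := card_le_card (subset_biUnion_of_mem
            (fun i : Fin s => ({t ∈ I | F.Absorbs H (ω t) (R i)} : Finset (Fin T))) hi))
  have hτI : ∀ i, τ i ∈ I := fun i => (mem_filter.1 (hτ i)).1
  have hωd : ∀ t ∈ I, ∀ t' ∈ I, t ≠ t' → Disjoint (univ.image (ω t)) (univ.image (ω t')) := by
    intro t ht t' ht' hne
    refine disjoint_left.2 fun v hv hv' => ?_
    obtain ⟨j, -, rfl⟩ := mem_image.1 hv
    obtain ⟨j', -, h⟩ := mem_image.1 hv'
    exact hdisj t ht t' ht' hne j j' h.symm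
  have hωY : ∀ t ∈ I, ∀ i, Disjoint (univ.image (ω t)) (univ.image (R i)) := by
    intro t ht i
    refine disjoint_left.2 fun v hv hv' => ?_
    obtain ⟨w, -, rfl⟩ := mem_image.1 hv'
    exact disjoint_left.1 hYI (mem_biUnion.2 ⟨t, ht, hv⟩) (hRY i w)
  have hRd : ∀ i i', i ≠ i' → Disjoint (univ.image (R i)) (univ.image (R i')) := by
    intro i i' hne
    refine disjoint_left.2 fun v hv hv' => ?_
    obtain ⟨w, -, rfl⟩ := mem_image.1 hv
    obtain ⟨w', -, h⟩ := mem_image.1 hv'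
    exact hne (hRinj _ _ _ _ h).1.symm
  have hused : Tiled F H (univ.biUnion fun i : Fin s =>
      univ.image (ω (τ i)) ∪ univ.image (R i)) := by
    refine Tiled.biUnion _ _ (fun i _ => ?_) fun i _ i' _ hne => ?_
    · refine (mem_filter.1 (hτ i)).2.tiled (hinj _ (hτI i))
        (fun w w' h => (hRinj _ _ _ _ h).2) fun x w h => ?_
      exact disjoint_left.1 (hωY _ (hτI i) i) (mem_image_of_mem _ (mem_univ x))
        (h ▸ mem_image_of_mem _ (mem_univ w))
    · rw [disjoint_union_left, disjoint_union_right, disjoint_union_right]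
      exact ⟨⟨hωd _ (hτI i) _ (hτI i') (hτi.ne hne), hωY _ (hτI i) i'⟩,
        (hωY _ (hτI i') i).symm, hRd i i' hne⟩
  have hunused : Tiled F H ((I \ univ.image τ).biUnion fun t => univ.image (ω t)) :=
    Tiled.biUnion _ _ (fun t ht => Tiled.image_matrix (hinj t (mem_sdiff.1 ht).1)
      (hrow t (mem_sdiff.1 ht).1)) fun t ht t' ht' hne =>
      hωd t (mem_sdiff.1 ht).1 t' (mem_sdiff.1 ht').1 hne
  have hunion : (I.biUnion fun t => univ.image (ω t)) ∪ Y
      = ((I \ univ.image τ).biUnion fun t => univ.image (ω t)) ∪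
        univ.biUnion fun i : Fin s => univ.image (ω (τ i)) ∪ univ.image (R i) := by
    ext v
    constructor
    · intro hv
      rcases mem_union.1 hv with hv | hv
      · obtain ⟨t, ht, hvt⟩ := mem_biUnion.1 hv
        by_cases hτt : t ∈ univ.image τ
        · obtain ⟨i, -, rfl⟩ := mem_image.1 hτt
          exact mem_union_right _ (mem_biUnion.2 ⟨i, mem_univ _, mem_union_left _ hvt⟩)
        · exact mem_union_left _ (mem_biUnion.2 ⟨t, mem_sdiff.2 ⟨ht, hτt⟩, hvt⟩)
      · refine mem_union_right _ (mem_biUnion.2 ⟨(e.symm ⟨v, hv⟩).1, mem_univ _,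
          mem_union_right _ (mem_image.2 ⟨(e.symm ⟨v, hv⟩).2, mem_univ _, ?_⟩)⟩)
        simp [R]
    · intro hv
      rcases mem_union.1 hv with hv | hv
      · obtain ⟨t, ht, hvt⟩ := mem_biUnion.1 hv
        exact mem_union_left _ (mem_biUnion.2 ⟨t, (mem_sdiff.1 ht).1, hvt⟩)
      · obtain ⟨i, -, hvi⟩ := mem_biUnion.1 hv
        rcases mem_union.1 hvi with hvi | hvi
        · exact mem_union_left _ (mem_biUnion.2 ⟨τ i, hτI i, hvi⟩)
        · obtain ⟨w, -, rfl⟩ := mem_image.1 hvi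
          exact mem_union_right _ (hRY i w)
  rw [hunion]
  refine hunused.union hused ?_
  rw [disjoint_biUnion_left]
  intro t ht
  rw [disjoint_biUnion_right]
  intro i _
  obtain ⟨htI, htτ⟩ := mem_sdiff.1 ht
  rw [disjoint_union_right]
  refine ⟨hωd t htI _ (hτI i) fun h => htτ ?_, hωY t htI i⟩
  rw [h]
  exact mem_image_of_mem τ (mem_univ i)

/-- No bound on the size of the absorbing family is needed: the leftover of a maximal tiling outside
it is below ξ n in any case, and divisibility passes to the leftover because everything else is
tiled. -/
theorem edgeCOVER_subset_edgeFACTOR [Nonempty W] (hk : 1 ≤ k) :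
    edgeCOVER k 1 W ⊆ edgeFACTOR k 1 W := by
  intro F hF
  refine Set.mem_ofPred.2 ?_
  intro p α hp hp1 hα hα1
  obtain ⟨μ₁, c₁, hμ₁, hc₁, habs⟩ := exists_card_absorbs_ge hk hF hp hp1 hα
  obtain ⟨n₂, ξ, hξ, hfam⟩ := exists_disjoint_family (J := W × W) (ι := W) (c := min c₁ 1)
    (by positivity) (min_le_right _ _)
  obtain ⟨n₃, μ₃, hμ₃, hemb⟩ := exists_isHom_into hk hF hp hp1 hξ
  refine ⟨n₂ + n₃, min μ₁ μ₃, by positivity, ?_⟩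
  intro V _ H hn hd hdeg hdvd
  have hd' := (H.isEdgeDense_iff hk _ _).1 hd
  obtain ⟨T, ω, I₀, hinj, hdisj, hmany⟩ := hfam V (by omega)
    (fun R => ({a | F.RowsHom H a ∧ F.Absorbs H a R} : Finset (W × W → V))) (fun R => by
      refine le_trans ?_ (habs V H (hd'.mono (min_le_left _ _))
        (fun v => hdeg.trans (by exact_mod_cast H.minDegree_le_tupleDegree v)) R)
      gcongr
      exact min_le_left _ _)
  -- Matrices that absorb nothing must still be tileable, so only those whose rows are homomorphisms
  -- are kept; the serving ones all survive.
  set I : Finset (Fin T) := {t ∈ I₀ | F.RowsHom H (ω t)} with hI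
  have hI₀ : ∀ t ∈ I, t ∈ I₀ := fun t ht => (mem_filter.1 ht).1
  set A : Finset V := I.biUnion fun t => univ.image (ω t) with hA
  have hmany' : ∀ R : W → V, ξ * Fintype.card V ≤ #{t ∈ I | F.Absorbs H (ω t) R} := by
    intro R
    refine (hmany R).trans (Nat.cast_le.2 (card_le_card fun t ht => ?_))
    obtain ⟨ht, htR⟩ := mem_filter.1 ht
    have htR' := (mem_filter.1 htR).2
    exact mem_filter.2 ⟨mem_filter.2 ⟨ht, htR'.1⟩, htR'.2⟩
  -- If at least ξ n vertices were left over, they would contain another copy of F, contradicting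
  -- maximality.
  obtain ⟨U, hU, hUmax⟩ := exists_max_image
    ({U | Tiled F H U ∧ Disjoint A U} : Finset (Finset V)) card
    ⟨∅, mem_filter.2 ⟨mem_univ _, Tiled.empty, disjoint_empty_right _⟩⟩
  obtain ⟨-, hUt, hAU⟩ := mem_filter.1 hU
  set Y : Finset V := (A ∪ U)ᶜ with hY
  have hAY : Disjoint A Y := by
    rw [hY]
    exact disjoint_compl_right.mono_left subset_union_left
  have hYlt : (#Y : ℝ) < ξ * Fintype.card V := by
    by_contra! hle
    obtain ⟨g, hg, hgi, hgY⟩ := hemb V H (by omega) (hd'.mono (min_le_right _ _)) Y hle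
    have hgU : ∀ w, g w ∉ U := fun w hw => by
      have := hgY w
      rw [hY, mem_compl, mem_union, not_or] at this
      exact this.2 hw
    have h1 := hUmax (univ.image g ∪ U) (mem_filter.2 ⟨mem_univ _,
      Tiled.cons g hg hgi U hUt hgU, by
        rw [disjoint_union_right]
        refine ⟨disjoint_right.2 fun v hv hvA => ?_, hAU⟩
        obtain ⟨w, -, rfl⟩ := mem_image.1 hv
        exact disjoint_left.1 hAY hvA (hgY w)⟩)
    rw [card_union_of_disjoint (disjoint_left.2 fun v hv => by
      obtain ⟨w, -, rfl⟩ := mem_image.1 hv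
      exact hgU w), card_image_of_injective _ hgi, card_univ] at h1
    have h2 : 0 < Fintype.card W := Fintype.card_pos
    omega
  have hrow : ∀ t ∈ I, F.RowsHom H (ω t) := fun t ht => (mem_filter.1 ht).2
  have hAt : Tiled F H A := by
    refine Tiled.biUnion _ _ (fun t ht => Tiled.image_matrix (hinj t (hI₀ t ht)) (hrow t ht))
      fun t ht t' ht' hne => disjoint_left.2 fun v hv hv' => ?_
    obtain ⟨j, -, rfl⟩ := mem_image.1 hv
    obtain ⟨j', -, h⟩ := mem_image.1 hv'
    exact hdisj t (hI₀ t ht) t' (hI₀ t' ht') hne j j' h.symm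
  have hYdvd : Fintype.card W ∣ #Y := by
    rw [hY, card_compl]
    exact Nat.dvd_sub hdvd (hAt.union hUt hAU).card_dvd
  obtain ⟨s, hs⟩ := hYdvd
  have hsY : s ≤ #Y := by
    rw [hs]
    exact Nat.le_mul_of_pos_left s Fintype.card_pos
  have hAYt : Tiled F H (A ∪ Y) := by
    refine tiled_absorbing_union hrow (fun t ht => hinj t (hI₀ t ht))
      (fun t ht t' ht' => hdisj t (hI₀ t ht) t' (hI₀ t' ht')) (s := s) (fun R => ?_)
      (by rw [hs, mul_comm]) hAY
    have h1 : (s : ℝ) ≤ #{t ∈ I | F.Absorbs H (ω t) R} :=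
      (Nat.cast_le.2 hsY).trans (hYlt.le.trans (hmany' R))
    exact_mod_cast h1
  have hfin := hAYt.union hUt (by
    rw [disjoint_union_left]
    refine ⟨hAU, ?_⟩
    rw [hY]
    exact disjoint_compl_left.mono_right subset_union_right)
  have huniv : A ∪ Y ∪ U = univ := by
    rw [union_right_comm, hY, union_compl]
  rw [huniv] at hfin
  exact hfin.hasFactor

end KGraph

/-- For every `k ≥ 2`, `FACTOR_k^{edge,1} = COVER_k^{edge,1}`, as collections of `k`-graphs `F`
with a non-empty finite vertex set `W`. -/
theorem theorem1p6 (k : ℕ) (hk : 2 ≤ k) (W : Type*) [Fintype W] [Nonempty W] :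
    KGraph.edgeFACTOR k 1 W = KGraph.edgeCOVER k 1 W := by
  have hk1 : 1 ≤ k := by omega
  exact Set.Subset.antisymm (KGraph.edgeFACTOR_subset_edgeCOVER hk1)
    (KGraph.edgeCOVER_subset_edgeFACTOR hk1)
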